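/- **Setting.** Let $n\ge 2$, $m\ge 0$, $N=2m$, $2^\sharp:=\frac{2n}{n-1}$. Let $\sigma_1,\dots,\sigma_n\in\mathbb C^{m\times m}$ be such that the Hermitian $N\times N$ matrices $$\alpha_j=\begin{pmatrix}0&\sigma_j^*\\ \sigma_j&0\end{pmatrix},\qquad 1\le j\le n,$$ satisfy $\alpha_j\alpha_k+\alpha_k\alpha_j=2\delta_{jk}I_N$ for $1\le j,k\le n$. (This contains the case of Hermitian $\sigma_j$ with $\sigma_j\sigma_k+\sigma_k\sigma_j=2\delta_{jk}I_m$ and, for $n=2$, $m=1$, $\sigma_1=1$, $\sigma_2=i$, the first two Pauli matrices.) Let $\mathcal D=-i\sum_{j=1}^n\alpha_j\partial_{x_j}$ and, for $0\ne x\in\mathbb R^n$, $$\mathcal U(x)=\begin{pmatrix}0&-iA(x)^*\\ iA(x)&0\end{pmatrix},\qquad A(x)=\sum_{j=1}^n\frac{x_j}{|x|}\sigma_j .$$ Let $h:\mathbb R^n\times\mathbb C^N\to\mathbb C^{N\times N}$ satisfy, for some $C<\infty$, $$\|h(x,z)\|\le C\,|z|^{2^\sharp-2}\qquad\text{for all }x\in\mathbb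 R^n,\ z\in\mathbb C^N .$$ Let $\psi\in L^{2^\sharp}(\mathbb R^n,\mathbb C^N)$ be a weak solution of $\mathcal D\psi=h(x,\psi)\psi$, that is, $x\mapsto h(x,\psi(x))\psi(x)$ is (Lebesgue) measurable and $$\int_{\mathbb R^n}\langle\mathcal D\phi,\psi\rangle\,dx=\int_{\mathbb R^n}\langle\phi,h(x,\psi)\psi\rangle\,dx\qquad\text{for all }\phi\in C_c^\infty(\mathbb R^n,\mathbb C^N).$$ **Theorem 1.1.** After modification on a set of measure zero, $\psi$ has the following properties. 1. $\psi\in C^{0,\alpha}(\mathbb R^n,\mathbb C^N)$ for every $0<\alpha<1$, that is, $\psi$ is bounded and uniformly Hölder continuous of exponent $\alpha$ on $\mathbb R^n$. 2. There is a $\Psi\in\mathbb C^N$ such that for every real $\alpha<1$ there is a $C_\alpha<\infty$ with $$\left|\psi(x)-|x|^{-n+1}\,\mathcal U(x)\Psi\right|\le C_\alpha\,|x|^{-n+1-\alpha}\qquad\text{for all }|x|\ge1 .$$ 3. In particular, there is a $C<\infty$ with $|\psi(x)|\le \dfrac{C}{1+|x|^{n-1}}$ for all $x\in\mathbb R^n$.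 -/

import Mathlib

open scoped NNReal ContDiff Matrix

noncomputable section

/-- The spinor space `ℂᴺ`, `N = 2 m`, with its Hermitian norm, written as two blocks of size `m`. -/
abbrev Spinor (m : ℕ) : Type := EuclideanSpace ℂ (Fin m ⊕ Fin m)

/-- Complex `N × N` matrices, `N = 2 m`. -/
abbrev SpinorMatrix (m : ℕ) : Type := Matrix (Fin m ⊕ Fin m) (Fin m ⊕ Fin m) ℂ

/-- The action of a matrix on a spinor, as an operator on the Hermitian space `ℂᴺ`. The operator
norm of `matOp A` is the norm used for matrices. -/
def matOp {m : ℕ} (A : SpinorMatrix m) : Spinor m →L[ℂ] Spinor m :=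
  Matrix.toEuclideanCLM (𝕜 := ℂ) A

/-- The critical exponent `2♯ = 2n / (n - 1)`. -/
def critExp (n : ℕ) : ℝ := 2 * (n : ℝ) / ((n : ℝ) - 1)

/-- The matrices `α_j = (0, σ_j^*; σ_j, 0)`, which are Hermitian. If the `σ_j` are Hermitian they
are `(0, σ_j; σ_j, 0)`. If `n = 2`, `m = 1`, `σ_1 = 1`, `σ_2 = i` they are the first two Pauli
matrices. -/
def diracMatrix {n m : ℕ} (σ : Fin n → Matrix (Fin m) (Fin m) ℂ) (j : Fin n) : SpinorMatrix m :=
  Matrix.fromBlocks 0 (σ j)ᴴ (σ j) 0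

/-- The anticommutation relations `α_j α_k + α_k α_j = 2 δ_{jk}`. -/
def IsClifford {n m : ℕ} (α : Fin n → SpinorMatrix m) : Prop :=
  ∀ j k, α j * α k + α k * α j = if j = k then 2 else 0

/-- The Dirac operator `𝒟 φ = -i ∑ⱼ αⱼ ∂ⱼ φ` (applied to differentiable functions only). -/
def diracOp {n m : ℕ} (α : Fin n → SpinorMatrix m) (φ : EuclideanSpace ℝ (Fin n) → Spinor m)
    (x : EuclideanSpace ℝ (Fin n)) : Spinor m :=
  -Complex.I • ∑ j, matOp (α j) (fderiv ℝ φ x (EuclideanSpace.single j 1))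

/-- The matrix `𝒰(x) = (0, -i A^*; i A, 0)`, where `A = ∑ⱼ (xⱼ / |x|) σⱼ`, for `x ≠ 0`. -/
def kelvinMatrix {n m : ℕ} (σ : Fin n → Matrix (Fin m) (Fin m) ℂ)
    (x : EuclideanSpace ℝ (Fin n)) : SpinorMatrix m :=
  Matrix.fromBlocks
    0 (-Complex.I • (∑ j, ((x j / ‖x‖ : ℝ) : ℂ) • σ j)ᴴ)
    (Complex.I • ∑ j, ((x j / ‖x‖ : ℝ) : ℂ) • σ j) 0

/-- Weak solutions `ψ ∈ L^{2♯}(ℝⁿ, ℂᴺ)` of `𝒟 ψ = h(x, ψ) ψ`. The right side has to be a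
measurable function for the equation to make sense; all the integrals below converge if `h` in
addition satisfies `‖h(x, z)‖ ≤ C |z|^{2♯ - 2}`. -/
structure IsWeakSolution {n m : ℕ} (α : Fin n → SpinorMatrix m)
    (h : EuclideanSpace ℝ (Fin n) → Spinor m → SpinorMatrix m)
    (ψ : EuclideanSpace ℝ (Fin n) → Spinor m) : Prop where
  memLp : MeasureTheory.MemLp ψ (ENNReal.ofReal (critExp n)) MeasureTheory.volume
  rhs_measurable : MeasureTheory.AEStronglyMeasurable (fun x => matOp (h x (ψ x)) (ψ x))
    MeasureTheory.volume
  weak_eq : ∀ φ : EuclideanSpace ℝ (Fin n) → Spinor m, ContDiff ℝ ∞ φ → HasCompactSupport φ →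
    ∫ x, inner ℂ (diracOp α φ x) (ψ x) = ∫ x, inner ℂ (φ x) (matOp (h x (ψ x)) (ψ x))

/-- The class `C^{0,a}`: bounded functions that are uniformly Hölder continuous of exponent `a`. -/
def IsHolderClass {E F : Type*} [NormedAddCommGroup E] [NormedAddCommGroup F] (a : ℝ≥0)
    (f : E → F) : Prop :=
  (∃ B : ℝ, ∀ x, ‖f x‖ ≤ B) ∧ ∃ K : ℝ≥0, HolderWith K a f

end

/-!
Let `f = h(x, ψ) ψ` be the right-hand side of the equation and `I g(x) = ∫ |x - y|^{-(n-1)} g(y) dy`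
the Riesz potential of order one. The proof rests on the formula `ψ = G * f`, where
`G(x) = c⁻¹ i |x|^{-n} ∑ⱼ xⱼ αⱼ` is the fundamental solution of the Dirac operator. Since
`|f| ≤ C |ψ|^q`, `q = 2♯ - 1 = (n+1)/(n-1)`, it gives the scalar inequality
`|ψ| ≤ C I(|ψ|^q)`, and all estimates on `ψ` follow from this inequality and the formula.

*Representation* (`IsWeakSolution.ae_eq_diracPotential`). The weak equation is tested with
`y ↦ κ(|y - x|²) ∑ⱼ (y - x)ⱼ αⱼ v`, where `κ(s)` is `s^{-n/2}` smoothly cut off at radii `1/k` and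
`k`. By the Clifford relations the Dirac operator maps this function to `-i (2sκ' + nκ) v`, which is
the difference of two bumps of equal mass and radii `1/k` and `k`. As `k → ∞`, the first one recovers
`ψ(x)` at Lebesgue points and the second one disappears because `ψ ∈ L^{2♯}`.

*Boundedness* (`exists_ae_le_of_critical`). Weak Lebesgue spaces are described by the bounds
`∫_S g ≤ A |S|^s`, for which the Hardy–Littlewood–Sobolev inequality
(`exists_weakBound_rieszPotential`) is a computation with the layer cake formula. Writing
`|ψ|^q = V |ψ|` with `V ∈ L^n`, the part of `V` over the set where `|ψ|` is large has small norm, so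
`w ↦ I(V w)` is a contraction on all relevant weak spaces simultaneously, and the rest of the potential
is bounded. Iterating `u ≤ T u + F` therefore puts `ψ` into every weak space
(`exists_weakBound_of_critical`), and Hölder's inequality gives a bound.

*Decay* (`exists_ae_le_rpow_of_critical`). The scalar inequality is invariant under the Kelvin
transform `u ↦ |x|^{-(n-1)} u(x / |x|²)`, which preserves the `L^{2♯}` norm. The bound for the
transformed function is the decay `|ψ(x)| ≤ C |x|^{-(n-1)}`; hence `|f(x)| ≤ C (1 + |x|)^{-(n+1)}`.

*Hölder continuity and asymptotics*. The kernel satisfies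
`|G(z) - G(w)| ≤ C |z - w|^a (|z|^{-(n-1)-a} + |w|^{-(n-1)-a})` for `0 ≤ a ≤ 1`
(`exists_enorm_diracKernel_sub_le`). Applied to `z = x - y`, `w = x' - y` it gives the Hölder bound, and
applied to `z = x - y`, `w = x` it gives `|G * f(x) - G(x) ∫ f| ≤ C |x|^{-(n-1)-a}`. Finally
`G(x) ∫ f = |x|^{-(n-1)} 𝒰(x) Ψ` for `Ψ = c⁻¹ diag(1, -1) ∫ f`.
-/

open MeasureTheory Metric Set Filter
open scoped ENNReal Topology

/-! ### One-dimensional integrals and the layer cake formula -/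

/-- Points of `ℝⁿ`. -/
abbrev Euc (n : ℕ) : Type := EuclideanSpace ℝ (Fin n)

theorem lintegral_Ioc_rpow {θ T B : ℝ} (hθ : θ < 1) (hT : 0 ≤ T) (hB : 0 ≤ B) :
    ∫⁻ t in Ioc 0 T, ENNReal.ofReal (B * t ^ (-θ)) = ENNReal.ofReal (B * (T ^ (1 - θ) / (1 - θ))) := by
  have hi : IntervalIntegrable (fun t : ℝ => t ^ (-θ)) volume 0 T :=
    intervalIntegral.intervalIntegrable_rpow' (by linarith)
  have hi' : IntegrableOn (fun t : ℝ => B * t ^ (-θ)) (Ioc 0 T) :=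
    ((intervalIntegrable_iff_integrableOn_Ioc_of_le hT).1 hi).const_mul B
  rw [← ofReal_integral_eq_lintegral_ofReal hi' ?_]
  · rw [integral_const_mul, ← intervalIntegral.integral_of_le hT, integral_rpow (Or.inl (by linarith))]
    rw [Real.zero_rpow (by linarith)]
    congr 3
    · ring_nf
    · ring
  · filter_upwards [ae_restrict_mem measurableSet_Ioc] with t ht
    exact mul_nonneg hB (Real.rpow_nonneg ht.1.le _)

theorem lintegral_Ioi_rpow {γ T B : ℝ} (hγ : 1 < γ) (hT : 0 < T) (hB : 0 ≤ B) :
    ∫⁻ t in Ioi T, ENNReal.ofReal (B * t ^ (-γ)) = ENNReal.ofReal (B * (T ^ (1 - γ) / (γ - 1))) := by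
  have hi' : IntegrableOn (fun t : ℝ => B * t ^ (-γ)) (Ioi T) :=
    (integrableOn_Ioi_rpow_of_lt (by linarith) hT).const_mul B
  rw [← ofReal_integral_eq_lintegral_ofReal hi' ?_]
  · rw [integral_const_mul, integral_Ioi_rpow_of_lt (by linarith) hT]
    congr 2
    rw [show -γ + 1 = 1 - γ by ring, show 1 - γ = -(γ - 1) by ring, neg_div_neg_eq]
  · filter_upwards [ae_restrict_mem measurableSet_Ioi] with t ht
    exact mul_nonneg hB (Real.rpow_nonneg (hT.trans ht).le _)

/-- The layer cake formula for functions with values in `[0, ∞]`. -/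
theorem lintegral_eq_lintegral_meas_ofReal_lt {α : Type*} [MeasurableSpace α] {μ : Measure α}
    {g : α → ℝ≥0∞} (hg : AEMeasurable g μ) (hfin : ∀ᵐ x ∂μ, g x ≠ ⊤) :
    ∫⁻ x, g x ∂μ = ∫⁻ t in Ioi (0 : ℝ), μ {x | ENNReal.ofReal t < g x} := by
  have h1 : ∫⁻ x, g x ∂μ = ∫⁻ x, ENNReal.ofReal (g x).toReal ∂μ := by
    refine lintegral_congr_ae ?_
    filter_upwards [hfin] with x hx
    rw [ENNReal.ofReal_toReal hx]
  rw [h1, lintegral_eq_lintegral_meas_lt μ (Eventually.of_forall fun x => ENNReal.toReal_nonneg)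
    hg.ennreal_toReal]
  refine setLIntegral_congr_fun measurableSet_Ioi fun t ht => ?_
  refine measure_congr ?_
  filter_upwards [hfin] with x hx
  exact propext (ENNReal.ofReal_lt_iff_lt_toReal (le_of_lt ht) hx).symm

/-- Absorption: a finite `k` with `t k ≤ K k ^ σ`, `σ < 1`, is bounded. -/
theorem le_rpow_of_mul_le_mul_rpow {t k K σ : ℝ} (ht : 0 < t) (hk : 0 ≤ k) (hK : 0 ≤ K)
    (hσ : σ < 1) (h : t * k ≤ K * k ^ σ) : k ≤ (K / t) ^ (1 / (1 - σ)) := by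
  rcases hk.eq_or_lt with rfl | hk
  · positivity
  have h1 : k ^ (1 - σ) ≤ K / t := by
    rw [Real.rpow_sub hk, Real.rpow_one, div_le_div_iff₀ (by positivity) ht]
    linarith
  calc k = (k ^ (1 - σ)) ^ (1 / (1 - σ)) := by
        rw [← Real.rpow_mul hk.le, mul_one_div_cancel (by linarith), Real.rpow_one]
    _ ≤ _ := Real.rpow_le_rpow (by positivity) h1 (by
        have : 0 < 1 - σ := by linarith
        positivity)

theorem le_ofReal_rpow_toReal_add_one {J : ℝ≥0∞} (hJ : J ≠ ⊤) {p : ℝ} (hp : 0 < p) :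
    J ≤ ENNReal.ofReal ((J.toReal ^ (1 / p) + 1) ^ p) := by
  nth_rw 1 [← ENNReal.ofReal_toReal hJ]
  refine ENNReal.ofReal_le_ofReal ?_
  calc J.toReal = (J.toReal ^ (1 / p)) ^ p := by
        rw [← Real.rpow_mul ENNReal.toReal_nonneg, one_div_mul_cancel hp.ne', Real.rpow_one]
    _ ≤ _ := Real.rpow_le_rpow (by positivity) (by linarith) hp.le

/-! ### Integrals of the Riesz kernel -/

section Kernel
variable {n : ℕ}

theorem measurable_riesz_kernel (b : ℝ) :
    Measurable (fun p : Euc n × Euc n => ‖p.1 - p.2‖ₑ ^ b) := by fun_prop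

theorem lintegral_ball_riesz_kernel_one [NeZero n] {b : ℝ} (hb : b < n) :
    ∫⁻ y in ball (0 : Euc n) 1, ‖y‖ₑ ^ (-b) < ⊤ := by
  have hd : 1 ≤ Module.finrank ℝ (Euc n) := by simpa using NeZero.one_le
  have h : IntegrableOn (fun y : Euc n => ‖y‖ ^ (-b)) (ball 0 1) volume := by
    refine integrableOn_ball_of_norm_le_rpow (C := 1) (α := b) hd (by simpa using hb) ?_ ?_
    · refine Eventually.of_forall fun x => ?_
      rw [Real.norm_of_nonneg (by positivity), one_mul]
    · exact (by fun_prop : Measurable fun y : Euc n => ‖y‖ ^ (-b)).aestronglyMeasurable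
  have h2 := h.hasFiniteIntegral
  refine lt_of_le_of_lt (le_of_eq ?_) h2
  refine lintegral_congr_ae ?_
  refine ae_restrict_of_ae ?_
  have : ∀ᵐ y : Euc n, y ≠ 0 := by
    have : Nonempty (Fin n) := ⟨0⟩
    simp [ae_iff, measure_singleton]
  filter_upwards [this] with y hy
  rw [← ofReal_norm, ← ofReal_norm, Real.norm_of_nonneg (by positivity),
    ENNReal.ofReal_rpow_of_pos (norm_pos_iff.2 hy)]

theorem exists_lintegral_ball_riesz_kernel_le [NeZero n] {b : ℝ} (hb : b < n) :
    ∃ C : ℝ, 0 < C ∧ ∀ (x : Euc n) (ρ : ℝ), 0 < ρ →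
      ∫⁻ y in ball x ρ, ‖x - y‖ₑ ^ (-b) ≤ ENNReal.ofReal (C * ρ ^ (n - b)) := by
  set J := ∫⁻ y in ball (0 : Euc n) 1, ‖y‖ₑ ^ (-b) with hJ
  have hJt : J < ⊤ := lintegral_ball_riesz_kernel_one hb
  refine ⟨J.toReal + 1, by positivity, fun x ρ hρ => ?_⟩
  have h1 : ∫⁻ y in ball x ρ, ‖x - y‖ₑ ^ (-b) = ∫⁻ z in ball (0 : Euc n) ρ, ‖z‖ₑ ^ (-b) := by
    rw [← lintegral_indicator measurableSet_ball, ← lintegral_indicator measurableSet_ball,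
      ← lintegral_sub_left_eq_self _ x]
    refine lintegral_congr fun y => ?_
    simp only [indicator, mem_ball, dist_eq_norm, sub_sub_cancel, sub_zero]
    rw [norm_sub_rev, sub_sub_cancel]
  have h2 : ∫⁻ z in ball (0 : Euc n) ρ, ‖z‖ₑ ^ (-b) = ENNReal.ofReal (ρ ^ (n - b)) * J := by
    have hmap := Measure.map_addHaar_smul (volume : Measure (Euc n)) hρ.ne'
    have h3 : ∫⁻ z, (ball (0 : Euc n) ρ).indicator (fun z => ‖z‖ₑ ^ (-b)) z
        ∂(Measure.map (fun y : Euc n => ρ • y) volume) = ENNReal.ofReal (ρ ^ (-b)) * J := by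
      rw [lintegral_map (by measurability) (by fun_prop), hJ,
        ← lintegral_indicator measurableSet_ball, ← lintegral_const_mul' _ _ ENNReal.ofReal_ne_top]
      refine lintegral_congr fun y => ?_
      have : ρ • y ∈ ball (0 : Euc n) ρ ↔ y ∈ ball (0 : Euc n) 1 := by
        simp only [mem_ball, dist_zero_right, norm_smul, Real.norm_of_nonneg hρ.le]
        rw [mul_lt_iff_lt_one_right hρ]
      by_cases hy : y ∈ ball (0 : Euc n) 1
      · rw [indicator_of_mem hy, indicator_of_mem (this.2 hy), enorm_smul,
          ENNReal.mul_rpow_of_ne_top enorm_ne_top enorm_ne_top, Real.enorm_of_nonneg hρ.le,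
          ENNReal.ofReal_rpow_of_pos hρ]
      · rw [indicator_of_notMem hy, indicator_of_notMem (fun h => hy (this.1 h)), mul_zero]
    rw [hmap, lintegral_smul_measure, lintegral_indicator measurableSet_ball, finrank_euclideanSpace_fin,
      smul_eq_mul, abs_of_pos (by positivity)] at h3
    have h4 : ENNReal.ofReal (ρ ^ n) * ENNReal.ofReal (ρ ^ n)⁻¹ = 1 := by
      rw [← ENNReal.ofReal_mul (by positivity), mul_inv_cancel₀ (by positivity), ENNReal.ofReal_one]
    calc ∫⁻ z in ball (0 : Euc n) ρ, ‖z‖ₑ ^ (-b)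
        = ENNReal.ofReal (ρ ^ n) * ENNReal.ofReal (ρ ^ n)⁻¹ * ∫⁻ z in ball (0 : Euc n) ρ, ‖z‖ₑ ^ (-b) := by
          rw [h4, one_mul]
      _ = _ := by
          rw [mul_assoc, h3, ← mul_assoc, ← ENNReal.ofReal_mul (by positivity), sub_eq_add_neg,
            Real.rpow_add hρ, Real.rpow_natCast]
  rw [h1, h2, ENNReal.ofReal_mul (by positivity), mul_comm]
  gcongr
  rw [← ENNReal.ofReal_toReal hJt.ne]
  exact ENNReal.ofReal_le_ofReal (by simp)

theorem exists_lintegral_compl_ball_riesz_kernel_le {b : ℝ} (hb : (n : ℝ) < b) :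
    ∃ C : ℝ, 0 < C ∧ ∀ x : Euc n,
      ∫⁻ y in (ball x 1)ᶜ, ‖x - y‖ₑ ^ (-b) ≤ ENNReal.ofReal C := by
  have hb0 : 0 < b := lt_of_le_of_lt (Nat.cast_nonneg n) hb
  have h := finite_integral_one_add_norm (μ := (volume : Measure (Euc n))) (r := b) (by simpa using hb)
  set J := ∫⁻ y : Euc n, ENNReal.ofReal ((1 + ‖y‖) ^ (-b)) with hJ
  refine ⟨(2 ^ b * J.toReal) + 1, by positivity, fun x => ?_⟩
  calc ∫⁻ y in (ball x 1)ᶜ, ‖x - y‖ₑ ^ (-b)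
      ≤ ∫⁻ y in (ball x 1)ᶜ, ENNReal.ofReal (2 ^ b) * ENNReal.ofReal ((1 + ‖x - y‖) ^ (-b)) := by
        refine setLIntegral_mono' measurableSet_ball.compl fun y hy => ?_
        have hy1 : 1 ≤ ‖x - y‖ := by
          simpa [mem_ball, dist_eq_norm, norm_sub_rev] using hy
        have hy0 : 0 < ‖x - y‖ := by linarith
        rw [← ofReal_norm, ENNReal.ofReal_rpow_of_pos hy0, ← ENNReal.ofReal_mul (by positivity)]
        refine ENNReal.ofReal_le_ofReal ?_
        rw [Real.rpow_neg hy0.le, Real.rpow_neg (by positivity), ← div_eq_mul_inv, inv_eq_one_div,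
          div_le_div_iff₀ (by positivity) (by positivity), one_mul, ← Real.mul_rpow (by norm_num) hy0.le]
        exact Real.rpow_le_rpow (by positivity) (by linarith) hb0.le
    _ ≤ ∫⁻ y, ENNReal.ofReal (2 ^ b) * ENNReal.ofReal ((1 + ‖x - y‖) ^ (-b)) :=
        setLIntegral_le_lintegral _ _
    _ = ENNReal.ofReal (2 ^ b) * J := by
        rw [lintegral_const_mul' _ _ ENNReal.ofReal_ne_top, hJ,
          lintegral_sub_left_eq_self (fun z : Euc n => ENNReal.ofReal ((1 + ‖z‖) ^ (-b))) x]
    _ ≤ _ := by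
        nth_rw 1 [← ENNReal.ofReal_toReal (a := J) h.ne]
        rw [← ENNReal.ofReal_mul (by positivity)]
        exact ENNReal.ofReal_le_ofReal (le_add_of_nonneg_right zero_le_one)

theorem lintegral_riesz_kernel_le_of_far {b : ℝ} (hb : 0 ≤ b) (S : Set (Euc n))
    (hS : MeasurableSet S) (x : Euc n) {ρ : ℝ} (hρ : 0 < ρ) :
    ∫⁻ y in S \ ball x ρ, ‖x - y‖ₑ ^ (-b) ≤ ENNReal.ofReal (ρ ^ (-b)) * volume S := by
  calc ∫⁻ y in S \ ball x ρ, ‖x - y‖ₑ ^ (-b)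
      ≤ ∫⁻ y in S \ ball x ρ, ENNReal.ofReal (ρ ^ (-b)) := by
        refine setLIntegral_mono' (hS.diff measurableSet_ball) fun y hy => ?_
        have hy1 : ρ ≤ ‖x - y‖ := by
          simpa [mem_ball, dist_eq_norm, norm_sub_rev] using hy.2
        rw [← ofReal_norm, ENNReal.ofReal_rpow_of_pos (hρ.trans_le hy1)]
        exact ENNReal.ofReal_le_ofReal (Real.rpow_le_rpow_of_nonpos hρ hy1 (by linarith))
    _ ≤ _ := by
        rw [lintegral_const, Measure.restrict_apply_univ]
        gcongr
        exact sdiff_subset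

/-- The integral of the Riesz kernel over a set of given volume is largest, up to a constant, for
the ball around the pole. -/
theorem exists_lintegral_riesz_kernel_le_volume_rpow [NeZero n] :
    ∃ C : ℝ, 0 < C ∧ ∀ (x : Euc n) (S : Set (Euc n)), MeasurableSet S → volume S ≠ ⊤ →
      ∫⁻ y in S, ‖x - y‖ₑ ^ (-((n : ℝ) - 1)) ≤ ENNReal.ofReal (C * volume.real S ^ (1 / (n : ℝ))) := by
  have hn : (1 : ℝ) ≤ n := by exact_mod_cast NeZero.one_le (n := n)
  obtain ⟨C, hC, h⟩ := exists_lintegral_ball_riesz_kernel_le (n := n) (b := (n : ℝ) - 1) (by linarith)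
  refine ⟨C + 1, by positivity, fun x S hS hSf => ?_⟩
  rcases eq_or_ne (volume S) 0 with h0 | h0
  · rw [setLIntegral_measure_zero _ _ h0]; exact zero_le
  set m := volume.real S with hm
  have hm0 : 0 < m := ENNReal.toReal_pos h0 hSf
  have hvol : volume S = ENNReal.ofReal m := (ENNReal.ofReal_toReal hSf).symm
  set ρ := m ^ (1 / (n : ℝ)) with hρ
  have hρ0 : 0 < ρ := by positivity
  have hmρ : m = ρ ^ (n : ℝ) := by
    rw [hρ, ← Real.rpow_mul hm0.le, one_div_mul_cancel (by positivity), Real.rpow_one]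
  calc ∫⁻ y in S, ‖x - y‖ₑ ^ (-((n : ℝ) - 1))
      ≤ ∫⁻ y in ball x ρ ∪ S \ ball x ρ, ‖x - y‖ₑ ^ (-((n : ℝ) - 1)) :=
        lintegral_mono_set (by rw [union_sdiff_self]; exact subset_union_right)
    _ ≤ _ := lintegral_union_le _ _ _
    _ ≤ ENNReal.ofReal (C * ρ ^ ((n : ℝ) - (n - 1))) + ENNReal.ofReal (ρ ^ (-((n : ℝ) - 1))) * volume S :=
        add_le_add (h x ρ hρ0) (lintegral_riesz_kernel_le_of_far (by linarith) S hS x hρ0)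
    _ = _ := by
        rw [hvol, ← ENNReal.ofReal_mul (by positivity), ← ENNReal.ofReal_add (by positivity) (by positivity),
          hmρ, ← Real.rpow_add hρ0]
        congr 1
        rw [show (n : ℝ) - (n - 1) = 1 by ring, show -((n : ℝ) - 1) + n = 1 by ring, Real.rpow_one]
        ring

end Kernel

/-! ### Weak Lebesgue spaces and the Riesz potential -/

/-- The bound `∫_S f ≤ A |S| ^ s` over all sets of finite measure. For `s = 1 - 1 / r`, `1 < r`, it
says that `f` lies in the weak space `L^{r,∞}`, with a norm comparable to `A`. -/
def WeakBound {α : Type*} [MeasureSpace α] (s A : ℝ) (f : α → ℝ≥0∞) : Prop :=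
  ∀ S : Set α, MeasurableSet S → volume S ≠ ⊤ →
    ∫⁻ x in S, f x ≤ ENNReal.ofReal (A * volume.real S ^ s)

/-- The Riesz potential of order one, without a normalising constant. -/
noncomputable def rieszPotential {n : ℕ} (f : Euc n → ℝ≥0∞) (x : Euc n) : ℝ≥0∞ :=
  ∫⁻ y, ‖x - y‖ₑ ^ (-((n : ℝ) - 1)) * f y

section Weak
variable {α : Type*} [MeasureSpace α] {s A B : ℝ} {f g : α → ℝ≥0∞}

theorem WeakBound.mono (h : WeakBound s A g) (hfg : f ≤ᵐ[volume] g) : WeakBound s A f :=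
  fun S hS hSf => (lintegral_mono_ae (ae_restrict_of_ae hfg)).trans (h S hS hSf)

theorem WeakBound.mono_const (h : WeakBound s A f) (hAB : A ≤ B) : WeakBound s B f :=
  fun S hS hSf => (h S hS hSf).trans (ENNReal.ofReal_le_ofReal (by gcongr))

theorem WeakBound.add (hf : WeakBound s A f) (hg : WeakBound s B g) (hA : 0 ≤ A) (hB : 0 ≤ B)
    (hfm : Measurable f) : WeakBound s (A + B) (fun x => f x + g x) := by
  intro S hS hSf
  rw [lintegral_add_left hfm, add_mul, ENNReal.ofReal_add (by positivity) (by positivity)]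
  exact add_le_add (hf S hS hSf) (hg S hS hSf)

theorem WeakBound.ae_lt_top [SigmaFinite (volume : Measure α)] (h : WeakBound s A f)
    (hf : Measurable f) : ∀ᵐ x, f x < ⊤ := by
  rw [← Measure.restrict_univ (μ := (volume : Measure α)), ← iUnion_spanningSets (volume : Measure α),
    ae_restrict_iUnion_iff]
  intro i
  refine MeasureTheory.ae_lt_top hf (ne_top_of_le_ne_top ?_
    (h _ (measurableSet_spanningSets _ i) (measure_spanningSets_lt_top _ i).ne))
  exact ENNReal.ofReal_ne_top

/-- Interpolation between a weak bound and boundedness. -/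
theorem WeakBound.interpolate {s' : ℝ} (h : WeakBound s A f) (hb : ∀ x, f x ≤ ENNReal.ofReal B)
    (hA : 0 ≤ A) (hB : 0 ≤ B) (hss : s ≤ s') (hs' : s' ≤ 1) :
    WeakBound s' (A + B) f := by
  intro S hS hSf
  rcases eq_or_ne (volume S) 0 with h0 | h0
  · rw [setLIntegral_measure_zero _ _ h0]; exact zero_le
  have hm0 : 0 < volume.real S := ENNReal.toReal_pos h0 hSf
  rcases le_total (volume.real S) 1 with h1 | h1
  · calc ∫⁻ x in S, f x ≤ ∫⁻ x in S, ENNReal.ofReal B := lintegral_mono fun x => hb x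
      _ = ENNReal.ofReal (B * volume.real S ^ (1 : ℝ)) := by
        rw [lintegral_const, Measure.restrict_apply_univ, ENNReal.ofReal_mul hB, Real.rpow_one,
          measureReal_def, ENNReal.ofReal_toReal hSf]
      _ ≤ _ := by
        refine ENNReal.ofReal_le_ofReal (mul_le_mul (by linarith)
          (Real.rpow_le_rpow_of_exponent_ge hm0 h1 hs') (by positivity) (by positivity))
  · refine (h S hS hSf).trans (ENNReal.ofReal_le_ofReal (mul_le_mul (by linarith)
      (Real.rpow_le_rpow_of_exponent_le h1 hss) (by positivity) (by positivity)))

theorem WeakBound.measure_lt_le {S : Set α} (h : WeakBound s A f) (hA : 0 ≤ A) (hs : s < 1)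
    (hf : Measurable f) (hS : MeasurableSet S) (hSf : volume S ≠ ⊤) {t : ℝ} (ht : 0 < t) :
    volume.real (S ∩ {x | ENNReal.ofReal t < f x}) ≤ (A / t) ^ (1 / (1 - s)) := by
  set F := S ∩ {x | ENNReal.ofReal t < f x} with hF
  have hFm : MeasurableSet F := hS.inter (measurableSet_lt measurable_const hf)
  have hFf : volume F ≠ ⊤ := measure_ne_top_of_subset inter_subset_left hSf
  refine le_rpow_of_mul_le_mul_rpow ht ENNReal.toReal_nonneg hA hs ?_
  have h1 : ENNReal.ofReal (t * volume.real F) ≤ ENNReal.ofReal (A * volume.real F ^ s) := by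
    refine le_trans ?_ (h F hFm hFf)
    calc ENNReal.ofReal (t * volume.real F) = ∫⁻ x in F, ENNReal.ofReal t := by
          rw [lintegral_const, Measure.restrict_apply_univ, ENNReal.ofReal_mul ht.le,
            measureReal_def, ENNReal.ofReal_toReal hFf]
      _ ≤ _ := setLIntegral_mono' hFm fun x hx => hx.2.le
  exact (ENNReal.ofReal_le_ofReal_iff (by positivity)).1 h1

/-- Functions in weak `L^r` belong to `L^a` on sets of finite measure, for `a < r`. -/
theorem exists_lintegral_rpow_le_of_weakBound {a : ℝ} (hs : s < 1) (ha : 0 < a)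
    (has : a * (1 - s) < 1) :
    ∃ C : ℝ, 0 < C ∧ ∀ (A : ℝ) (f : α → ℝ≥0∞) (S : Set α), 0 < A → Measurable f → WeakBound s A f →
      MeasurableSet S → volume S ≠ ⊤ → volume S ≠ 0 →
      ∫⁻ x in S, f x ^ a ≤ ENNReal.ofReal (C * A ^ a * volume.real S ^ (1 - a * (1 - s))) := by
  have h1s : 0 < 1 - s := by linarith
  set γ := 1 / (a * (1 - s)) with hγ
  have hγ1 : 1 < γ := by rw [hγ, lt_div_iff₀ (by positivity)]; linarith
  have hγ0 : 0 < γ - 1 := by linarith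
  refine ⟨1 + 1 / (γ - 1), by positivity, fun A f S hA hf h hS hSf hS0 => ?_⟩
  set m := volume.real S with hm
  have hm0 : 0 < m := ENNReal.toReal_pos hS0 hSf
  have hvol : volume S = ENNReal.ofReal m := (ENNReal.ofReal_toReal hSf).symm
  set T := A ^ a * m ^ (-(a * (1 - s))) with hT
  have hT0 : 0 < T := by positivity
  have hfin : ∀ᵐ x ∂(volume.restrict S), f x ^ a ≠ ⊤ := by
    have := MeasureTheory.ae_lt_top (μ := volume.restrict S) hf
      (ne_top_of_le_ne_top ENNReal.ofReal_ne_top (h S hS hSf))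
    filter_upwards [this] with x hx
    exact ENNReal.rpow_ne_top_of_nonneg ha.le hx.ne
  have hkey : ∀ t : ℝ, 0 < t → volume.restrict S {x | ENNReal.ofReal t < f x ^ a}
      ≤ ENNReal.ofReal (A ^ (1 / (1 - s)) * t ^ (-γ)) := by
    intro t ht
    have hset : {x | ENNReal.ofReal t < f x ^ a} = {x | ENNReal.ofReal (t ^ (1 / a)) < f x} := by
      ext x
      simp only [mem_ofPred_eq]
      rw [← ENNReal.ofReal_rpow_of_pos ht, one_div, ENNReal.rpow_inv_lt_iff ha]
    rw [hset, Measure.restrict_apply (measurableSet_lt measurable_const hf), inter_comm]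
    have hFf : volume (S ∩ {x | ENNReal.ofReal (t ^ (1 / a)) < f x}) ≠ ⊤ :=
      measure_ne_top_of_subset inter_subset_left hSf
    rw [← ENNReal.ofReal_toReal hFf]
    refine ENNReal.ofReal_le_ofReal ((h.measure_lt_le hA.le hs hf hS hSf
      (Real.rpow_pos_of_pos ht _)).trans (le_of_eq ?_))
    rw [Real.div_rpow hA.le (by positivity), ← Real.rpow_mul ht.le, div_eq_mul_inv,
      ← Real.rpow_neg ht.le, hγ]
    congr 3
    field_simp
  rw [lintegral_eq_lintegral_meas_ofReal_lt (hf.pow_const a).aemeasurable hfin,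
    ← Ioc_union_Ioi_eq_Ioi hT0.le]
  calc _ ≤ _ := lintegral_union_le _ _ _
    _ ≤ ENNReal.ofReal (m * T) + ENNReal.ofReal (A ^ (1 / (1 - s)) * (T ^ (1 - γ) / (γ - 1))) := by
      refine add_le_add ?_ ?_
      · calc _ ≤ ∫⁻ t in Ioc (0 : ℝ) T, volume S :=
              lintegral_mono fun t =>
                (measure_mono (subset_univ _)).trans_eq (by rw [Measure.restrict_apply_univ])
          _ = _ := by
            rw [lintegral_const, Measure.restrict_apply_univ, Real.volume_Ioc, sub_zero, hvol,
              ← ENNReal.ofReal_mul hm0.le]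
      · rw [← lintegral_Ioi_rpow hγ1 hT0 (by positivity)]
        exact setLIntegral_mono' measurableSet_Ioi fun t ht => hkey t (hT0.trans ht)
    _ = _ := by
      rw [← ENNReal.ofReal_add (by positivity) (by positivity)]
      congr 1
      have e1 : T ^ (-γ) = A ^ (-(1 / (1 - s))) * m := by
        rw [hT, Real.mul_rpow (by positivity) (by positivity), ← Real.rpow_mul hA.le,
          ← Real.rpow_mul hm0.le, hγ]
        congr 1
        · congr 1; field_simp
        · rw [show -(a * (1 - s)) * -(1 / (a * (1 - s))) = 1 by field_simp, Real.rpow_one]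
      have e2 : A ^ (1 / (1 - s)) * T ^ (1 - γ) = m * T := by
        rw [sub_eq_add_neg (1 : ℝ) γ, Real.rpow_add hT0, Real.rpow_one, e1, Real.rpow_neg hA.le]
        field_simp
      have e3 : m * T = A ^ a * m ^ (1 - a * (1 - s)) := by
        rw [hT, sub_eq_add_neg 1 (a * (1 - s)), Real.rpow_add hm0, Real.rpow_one]; ring
      rw [← mul_div_assoc, e2, e3]
      ring

/-- Hölder's inequality: a function in `L^d` times a function in a weak space. -/
theorem exists_weakBound_mul {d : ℝ} (hd : 1 < d) (hs : s < 1) (hds : 1 / d < s) :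
    ∃ C : ℝ, 0 < C ∧ ∀ (A ε : ℝ) (V f : α → ℝ≥0∞), 0 < A → 0 < ε → Measurable f → Measurable V →
      WeakBound s A f → ∫⁻ x, V x ^ d ≤ ENNReal.ofReal (ε ^ d) →
      WeakBound (s - 1 / d) (C * ε * A) (fun x => V x * f x) := by
  set a := d / (d - 1) with ha
  have hd1 : 0 < d - 1 := by linarith
  have ha0 : 0 < a := by positivity
  have hconj : d.HolderConjugate a := Real.HolderConjugate.conjExponent hd
  have has : a * (1 - s) < 1 := by
    rw [ha, div_mul_eq_mul_div, div_lt_one hd1]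
    rw [div_lt_iff₀ (by linarith)] at hds
    nlinarith
  obtain ⟨C, hC, h⟩ := exists_lintegral_rpow_le_of_weakBound (α := α) hs ha0 has
  refine ⟨C ^ (1 / a), by positivity, fun A ε V f hA hε hf hV hw hVε S hS hSf => ?_⟩
  rcases eq_or_ne (volume S) 0 with h0 | h0
  · rw [setLIntegral_measure_zero _ _ h0]; exact zero_le
  have hm0 : 0 < volume.real S := ENNReal.toReal_pos h0 hSf
  calc ∫⁻ x in S, V x * f x
      ≤ (∫⁻ x in S, V x ^ d) ^ (1 / d) * (∫⁻ x in S, f x ^ a) ^ (1 / a) :=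
        ENNReal.lintegral_mul_le_Lp_mul_Lq _ hconj hV.aemeasurable hf.aemeasurable
    _ ≤ (ENNReal.ofReal (ε ^ d)) ^ (1 / d) *
        (ENNReal.ofReal (C * A ^ a * volume.real S ^ (1 - a * (1 - s)))) ^ (1 / a) := by
        gcongr
        · exact (setLIntegral_le_lintegral _ _).trans hVε
        · exact h A f S hA hf hw hS hSf h0
    _ = _ := by
        rw [ENNReal.ofReal_rpow_of_pos (by positivity), ENNReal.ofReal_rpow_of_pos (by positivity),
          ← ENNReal.ofReal_mul (by positivity)]
        congr 1
        rw [← Real.rpow_mul hε.le, mul_one_div_cancel (by positivity), Real.rpow_one,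
          Real.mul_rpow (by positivity) (by positivity), Real.mul_rpow (by positivity) (by positivity),
          ← Real.rpow_mul hA.le, mul_one_div_cancel (by positivity), Real.rpow_one,
          ← Real.rpow_mul hm0.le]
        have : (1 - a * (1 - s)) * (1 / a) = s - 1 / d := by
          rw [ha]; field_simp; ring
        rw [this]; ring

/-- Strong `L^p` bounds imply weak ones. -/
theorem weakBound_of_lintegral_rpow_le {p : ℝ} (hp : 1 < p) (hA : 0 < A) (hf : Measurable f)
    (h : ∫⁻ x, f x ^ p ≤ ENNReal.ofReal (A ^ p)) : WeakBound (1 - 1 / p) A f := by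
  intro S hS hSf
  have hp1 : 0 < p - 1 := by linarith
  have hconj : p.HolderConjugate (p / (p - 1)) := Real.HolderConjugate.conjExponent hp
  calc ∫⁻ x in S, f x = ∫⁻ x in S, (f * fun _ => (1 : ℝ≥0∞) : α → ℝ≥0∞) x := by simp
    _ ≤ (∫⁻ x in S, f x ^ p) ^ (1 / p) * (∫⁻ x in S, (1 : ℝ≥0∞) ^ (p / (p - 1))) ^ (1 / (p / (p - 1))) :=
        ENNReal.lintegral_mul_le_Lp_mul_Lq _ hconj hf.aemeasurable aemeasurable_const
    _ ≤ (ENNReal.ofReal (A ^ p)) ^ (1 / p) * (ENNReal.ofReal (volume.real S)) ^ (1 - 1 / p) := by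
        have e : 1 / (p / (p - 1)) = 1 - 1 / p := by field_simp
        have e' : 0 ≤ 1 - 1 / p := by rw [← e]; positivity
        rw [e]
        gcongr
        · exact (setLIntegral_le_lintegral _ _).trans h
        · rw [ENNReal.one_rpow, lintegral_const, Measure.restrict_apply_univ, one_mul,
            measureReal_def, ENNReal.ofReal_toReal hSf]
    _ = _ := by
        have : 1 / p < 1 := by rw [div_lt_one (by linarith)]; exact hp
        rw [ENNReal.ofReal_rpow_of_pos (by positivity),
          ENNReal.ofReal_rpow_of_nonneg measureReal_nonneg (by linarith),
          ← ENNReal.ofReal_mul (by positivity), ← Real.rpow_mul hA.le,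
          mul_one_div_cancel (by positivity), Real.rpow_one]

end Weak

section Riesz
variable {n : ℕ}

theorem measurable_rieszPotential {f : Euc n → ℝ≥0∞} (hf : Measurable f) :
    Measurable (rieszPotential f) := by
  unfold rieszPotential
  refine Measurable.lintegral_prod_right'
    (f := fun p : Euc n × Euc n => ‖p.1 - p.2‖ₑ ^ (-((n : ℝ) - 1)) * f p.2) ?_
  exact (measurable_riesz_kernel _).mul (hf.comp measurable_snd)

theorem rieszPotential_mono {f g : Euc n → ℝ≥0∞} (h : f ≤ᵐ[volume] g) (x : Euc n) :
    rieszPotential f x ≤ rieszPotential g x := by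
  refine lintegral_mono_ae ?_
  filter_upwards [h] with y hy
  gcongr

theorem rieszPotential_add {f g : Euc n → ℝ≥0∞} (hf : Measurable f) (x : Euc n) :
    rieszPotential (fun y => f y + g y) x = rieszPotential f x + rieszPotential g x := by
  unfold rieszPotential
  simp only [mul_add]
  refine lintegral_add_left ?_ _
  exact Measurable.mul (by fun_prop) hf

theorem rieszPotential_const_mul {f : Euc n → ℝ≥0∞} {c : ℝ≥0∞} (hc : c ≠ ⊤) (x : Euc n) :
    rieszPotential (fun y => c * f y) x = c * rieszPotential f x := by
  unfold rieszPotential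
  rw [← lintegral_const_mul' _ _ hc]
  refine lintegral_congr fun y => by ring

/-- The potential of an indicator function is small outside a set of controlled volume. -/
theorem measure_riesz_indicator_lt_le [NeZero n] {C : ℝ} (hn : 2 ≤ n) (hC : 0 < C)
    (h : ∀ (x : Euc n) (S : Set (Euc n)), MeasurableSet S → volume S ≠ ⊤ →
      ∫⁻ y in S, ‖x - y‖ₑ ^ (-((n : ℝ) - 1)) ≤ ENNReal.ofReal (C * volume.real S ^ (1 / (n : ℝ))))
    {S : Set (Euc n)} (hSf : volume S ≠ ⊤) {t : ℝ} (ht : 0 < t)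
    {g : Euc n → ℝ≥0∞} (hg : g = fun y => ∫⁻ x in S, ‖x - y‖ₑ ^ (-((n : ℝ) - 1))) :
    volume {y | ENNReal.ofReal t < g y} ≤
      ENNReal.ofReal ((C * volume.real S / t) ^ (1 / (1 - 1 / (n : ℝ)))) := by
  have hgm : Measurable g := by
    rw [hg]
    exact Measurable.lintegral_prod_left' (f := fun p : Euc n × Euc n => ‖p.1 - p.2‖ₑ ^ (-((n : ℝ) - 1)))
      (measurable_riesz_kernel _)
  set F := {y | ENNReal.ofReal t < g y} with hF
  have hFm : MeasurableSet F := measurableSet_lt measurable_const hgm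
  have hn' : (2 : ℝ) ≤ n := by exact_mod_cast hn
  -- `F` is exhausted by bounded sets, whose measure is known to be finite.
  have hball : ∀ R : ℕ, volume (F ∩ ball 0 (R : ℝ)) ≤
      ENNReal.ofReal ((C * volume.real S / t) ^ (1 / (1 - 1 / (n : ℝ)))) := by
    intro R
    set G := F ∩ ball 0 (R : ℝ) with hG
    have hGm : MeasurableSet G := hFm.inter measurableSet_ball
    have hGf : volume G ≠ ⊤ := measure_ne_top_of_subset inter_subset_right measure_ball_lt_top.ne
    rw [← ENNReal.ofReal_toReal hGf]
    refine ENNReal.ofReal_le_ofReal ?_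
    have hn1 : 1 / (n : ℝ) < 1 := by rw [div_lt_one (by linarith)]; linarith
    refine le_rpow_of_mul_le_mul_rpow ht ENNReal.toReal_nonneg
      (mul_nonneg hC.le ENNReal.toReal_nonneg) hn1 ?_
    refine (ENNReal.ofReal_le_ofReal_iff (by positivity)).1 ?_
    calc ENNReal.ofReal (t * (volume G).toReal) = ∫⁻ y in G, ENNReal.ofReal t := by
          rw [lintegral_const, Measure.restrict_apply_univ, ENNReal.ofReal_mul ht.le,
            ENNReal.ofReal_toReal hGf]
      _ ≤ ∫⁻ y in G, g y := setLIntegral_mono' hGm fun x hx => hx.1.le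
      _ = ∫⁻ x in S, ∫⁻ y in G, ‖x - y‖ₑ ^ (-((n : ℝ) - 1)) := by
          rw [hg]
          exact lintegral_lintegral_swap
            ((measurable_riesz_kernel _).comp measurable_swap).aemeasurable
      _ ≤ ∫⁻ x in S, ENNReal.ofReal (C * volume.real G ^ (1 / (n : ℝ))) :=
          lintegral_mono fun x => h x G hGm hGf
      _ = _ := by
          rw [lintegral_const, Measure.restrict_apply_univ, ← ENNReal.ofReal_toReal hSf,
            ← ENNReal.ofReal_mul (by positivity)]
          congr 1
          simp only [measureReal_def]
          ring
  have hU : F = ⋃ R : ℕ, F ∩ ball 0 (R : ℝ) := by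
    rw [← inter_iUnion, iUnion_ball_nat, inter_univ]
  rw [hU, Monotone.measure_iUnion]
  · exact iSup_le hball
  · intro i j hij
    exact inter_subset_inter_right _ (ball_subset_ball (by exact_mod_cast hij))

/-- The Hardy–Littlewood–Sobolev inequality for the potential of order one between weak spaces. -/
theorem exists_weakBound_rieszPotential (hn : 2 ≤ n) {s : ℝ} (hs0 : 0 ≤ s)
    (hs : s < 1 - 1 / (n : ℝ)) :
    ∃ C : ℝ, 0 < C ∧ ∀ (A : ℝ) (f : Euc n → ℝ≥0∞), 0 < A → Measurable f → WeakBound s A f →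
      WeakBound (s + 1 / n) (C * A) (rieszPotential f) := by
  have : NeZero n := ⟨by omega⟩
  have hn' : (2 : ℝ) ≤ n := by exact_mod_cast hn
  have hn1 : 0 < 1 - 1 / (n : ℝ) := by linarith
  obtain ⟨C, hC, h⟩ := exists_lintegral_riesz_kernel_le_volume_rpow (n := n)
  set θ := s / (1 - 1 / (n : ℝ)) with hθ
  have hθ1 : θ < 1 := by rw [hθ, div_lt_one hn1]; exact hs
  have hθ0 : 0 < 1 - θ := by linarith
  refine ⟨C / (1 - θ), by positivity, fun A f hA hf hw S hS hSf => ?_⟩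
  rcases eq_or_ne (volume S) 0 with h0 | h0
  · rw [setLIntegral_measure_zero _ _ h0]; exact zero_le
  set m := volume.real S with hm
  have hm0 : 0 < m := ENNReal.toReal_pos h0 hSf
  set g : Euc n → ℝ≥0∞ := fun y => ∫⁻ x in S, ‖x - y‖ₑ ^ (-((n : ℝ) - 1)) with hg
  have hgm : Measurable g :=
    Measurable.lintegral_prod_left' (f := fun p : Euc n × Euc n => ‖p.1 - p.2‖ₑ ^ (-((n : ℝ) - 1)))
      (measurable_riesz_kernel _)
  set T := C * m ^ (1 / (n : ℝ)) with hT
  have hT0 : 0 < T := by positivity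
  have hgT : ∀ y, g y ≤ ENNReal.ofReal T := by
    intro y
    refine le_trans (le_of_eq ?_) (h y S hS hSf)
    refine lintegral_congr fun x => ?_
    rw [← enorm_neg, neg_sub]
  have hmeas : ∀ t : ℝ, (volume.withDensity f) {y | ENNReal.ofReal t < g y} =
      ∫⁻ y in {y | ENNReal.ofReal t < g y}, f y := fun t =>
    withDensity_apply _ (measurableSet_lt measurable_const hgm)
  calc ∫⁻ x in S, rieszPotential f x
      = ∫⁻ y, f y * g y := by
        unfold rieszPotential
        rw [lintegral_lintegral_swap]
        · refine lintegral_congr fun y => ?_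
          rw [lintegral_mul_const _ (by fun_prop), mul_comm]
        · exact ((measurable_riesz_kernel _).mul (hf.comp measurable_snd)).aemeasurable
    _ = ∫⁻ y, g y ∂(volume.withDensity f) := by
        rw [lintegral_withDensity_eq_lintegral_mul _ hf hgm]; rfl
    _ = ∫⁻ t in Ioi (0 : ℝ), (volume.withDensity f) {y | ENNReal.ofReal t < g y} :=
        lintegral_eq_lintegral_meas_ofReal_lt hgm.aemeasurable
          (Eventually.of_forall fun y => ne_top_of_le_ne_top ENNReal.ofReal_ne_top (hgT y))
    _ ≤ (∫⁻ t in Ioc (0 : ℝ) T, (volume.withDensity f) {y | ENNReal.ofReal t < g y}) +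
        ∫⁻ t in Ioi T, (volume.withDensity f) {y | ENNReal.ofReal t < g y} := by
        rw [← Ioc_union_Ioi_eq_Ioi hT0.le]; exact lintegral_union_le _ _ _
    _ ≤ (∫⁻ t in Ioc (0 : ℝ) T, ENNReal.ofReal (A * (C * m) ^ θ * t ^ (-θ))) + ∫⁻ t in Ioi T, 0 := by
        refine add_le_add (setLIntegral_mono' measurableSet_Ioc fun t ht => ?_)
          (setLIntegral_mono' measurableSet_Ioi fun t ht => ?_)
        · rw [hmeas]
          have hv := measure_riesz_indicator_lt_le hn hC h hSf ht.1 hg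
          have hvf := ne_top_of_le_ne_top ENNReal.ofReal_ne_top hv
          refine (hw _ (measurableSet_lt measurable_const hgm) hvf).trans
            (ENNReal.ofReal_le_ofReal ?_)
          have ht0 : 0 < t := ht.1
          have hv' := ENNReal.toReal_le_of_le_ofReal (by positivity) hv
          rw [mul_assoc]
          refine mul_le_mul_of_nonneg_left ?_ hA.le
          calc _ ≤ ((C * m / t) ^ (1 / (1 - 1 / (n : ℝ)))) ^ s :=
                Real.rpow_le_rpow ENNReal.toReal_nonneg hv' hs0
            _ = _ := by
                rw [← Real.rpow_mul (by positivity), Real.div_rpow (by positivity) ht.1.le,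
                  Real.rpow_neg ht.1.le, div_eq_mul_inv, one_div_mul_eq_div]
        · rw [hmeas]
          have : {y | ENNReal.ofReal t < g y} = ∅ := by
            refine eq_empty_of_forall_notMem fun y hy => ?_
            exact absurd (lt_of_lt_of_le hy (hgT y)) (not_lt.2 (ENNReal.ofReal_le_ofReal (le_of_lt ht)))
          rw [this]; simp
    _ = _ := by
        rw [lintegral_zero, add_zero, lintegral_Ioc_rpow hθ1 hT0.le (by positivity)]
        congr 1
        have e : s + 1 / (n : ℝ) = θ + 1 / n * (1 - θ) := by
          have : s = θ * (1 - 1 / (n : ℝ)) := by rw [hθ, div_mul_cancel₀ _ hn1.ne']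
          rw [this]; ring
        rw [e, Real.rpow_add hm0, Real.rpow_mul hm0.le, hT, Real.mul_rpow hC.le hm0.le,
          Real.mul_rpow hC.le (by positivity), Real.rpow_sub hC, Real.rpow_one]
        field_simp

end Riesz

/-! ### Boundedness of subsolutions of the critical integral equation -/

section Critical
variable {n : ℕ}

theorem holderConjugate_critical (hn : 2 ≤ n) :
    (2 * (n : ℝ) / (n - 1)).HolderConjugate (2 * (n : ℝ) / (n + 1)) := by
  have hn' : (2 : ℝ) ≤ n := by exact_mod_cast hn
  have h1 : (0 : ℝ) < n - 1 := by linarith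
  rw [Real.holderConjugate_iff]
  constructor
  · rw [lt_div_iff₀ h1]; linarith
  · field_simp; ring

/-- By Hölder's inequality, the contribution to the potential of `u ^ q` from outside a unit ball is
bounded for `u ∈ L^{2♯}`. -/
theorem exists_lintegral_compl_ball_le (hn : 2 ≤ n) {u : Euc n → ℝ≥0∞} (hu : Measurable u)
    (hp : ∫⁻ x, u x ^ (2 * (n : ℝ) / (n - 1)) ≠ ⊤) :
    ∃ M : ℝ, 0 < M ∧ ∀ x, ∫⁻ y in (ball x 1)ᶜ, ‖x - y‖ₑ ^ (-((n : ℝ) - 1)) *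
      u y ^ (((n : ℝ) + 1) / (n - 1)) ≤ ENNReal.ofReal M := by
  have hn' : (2 : ℝ) ≤ n := by exact_mod_cast hn
  have h1 : (0 : ℝ) < n - 1 := by linarith
  set p := 2 * (n : ℝ) / (n - 1) with hpdef
  set J := ∫⁻ x, u x ^ p with hJ
  obtain ⟨C, hC, h⟩ := exists_lintegral_compl_ball_riesz_kernel_le (n := n) (b := 2 * n) (by linarith)
  have hp0 : 0 < p := by positivity
  set p' := 2 * (n : ℝ) / (n + 1) with hp'
  have hp'0 : 0 < p' := by positivity
  set Q : ℝ≥0∞ := ENNReal.ofReal C ^ (1 / p) * J ^ (1 / p') with hQ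
  have hQt : Q ≠ ⊤ := ENNReal.mul_ne_top
    (ENNReal.rpow_ne_top_of_nonneg (by positivity) ENNReal.ofReal_ne_top)
    (ENNReal.rpow_ne_top_of_nonneg (by positivity) hp)
  refine ⟨Q.toReal + 1, by positivity, fun x => ?_⟩
  have hle : ENNReal.ofReal Q.toReal ≤ ENNReal.ofReal (Q.toReal + 1) :=
    ENNReal.ofReal_le_ofReal (by linarith)
  refine le_trans ?_ hle
  rw [ENNReal.ofReal_toReal hQt]
  calc _ ≤ (∫⁻ y in (ball x 1)ᶜ, (‖x - y‖ₑ ^ (-((n : ℝ) - 1))) ^ p) ^ (1 / p) *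
        (∫⁻ y in (ball x 1)ᶜ, (u y ^ (((n : ℝ) + 1) / (n - 1))) ^ p') ^ (1 / p') :=
        ENNReal.lintegral_mul_le_Lp_mul_Lq _ (holderConjugate_critical hn)
          (by fun_prop) (hu.pow_const _).aemeasurable
    _ ≤ _ := by
        rw [hQ]
        gcongr
        · refine le_trans (le_of_eq ?_) (h x)
          refine lintegral_congr fun y => ?_
          rw [← ENNReal.rpow_mul, hpdef]
          congr 1
          field_simp
        · refine le_trans (setLIntegral_le_lintegral _ _) (le_of_eq ?_)
          refine lintegral_congr fun y => ?_
          rw [← ENNReal.rpow_mul, hpdef, hp']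
          congr 1
          field_simp

/-- If `u ≤ T u + F` with `T` a contraction of both a large and a small weak space, then a function
`u` of the large space lies in the small space as soon as `F` does. -/
theorem weakBound_of_contraction {α : Type*} [MeasureSpace α]
    {T : (α → ℝ≥0∞) → α → ℝ≥0∞} {s s₀ A₀ B : ℝ} {u F : α → ℝ≥0∞}
    (hTm : ∀ w, Measurable w → Measurable (T w))
    (hTmono : ∀ w v, w ≤ᵐ[volume] v → ∀ x, T w x ≤ T v x)
    (hTadd : ∀ w v, Measurable w → ∀ x, T (fun y => w y + v y) x = T w x + T v x)
    (hT : ∀ A w, 0 < A → Measurable w → WeakBound s A w → WeakBound s (A / 2) (T w))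
    (hT₀ : ∀ A w, 0 < A → Measurable w → WeakBound s₀ A w → WeakBound s₀ (A / 2) (T w))
    (hu : Measurable u) (hF : Measurable F) (hB : 0 < B) (hA₀ : 0 < A₀)
    (huF : ∀ᵐ x, u x ≤ T u x + F x) (hFB : WeakBound s B F) (huA : WeakBound s₀ A₀ u) :
    WeakBound s (2 * B) u := by
  have key : ∀ k : ℕ, ∃ a b : α → ℝ≥0∞, Measurable a ∧ Measurable b ∧ WeakBound s (2 * B) a ∧
      WeakBound s₀ (A₀ / 2 ^ k) b ∧ ∀ᵐ x, u x ≤ a x + b x := by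
    intro k
    induction k with
    | zero =>
      refine ⟨fun _ => 0, u, measurable_const, hu, ?_, by simpa using huA, ?_⟩
      · intro S _ _; simp
      · filter_upwards with x; simp
    | succ k ih =>
      obtain ⟨a, b, ha, hb, hwa, hwb, hab⟩ := ih
      refine ⟨fun x => T a x + F x, T b, (hTm a ha).add hF, hTm b hb, ?_, ?_, ?_⟩
      · have := (hT _ a (by positivity) ha hwa).add hFB (by positivity) hB.le (hTm a ha)
        convert this using 1
        ring
      · have := hT₀ _ b (by positivity) hb hwb
        convert this using 1
        rw [pow_succ, div_div]
      · filter_upwards [huF] with x hx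
        calc u x ≤ T u x + F x := hx
          _ ≤ T (fun y => a y + b y) x + F x := by gcongr; exact hTmono _ _ hab x
          _ = _ := by rw [hTadd a b ha]; ring
  intro S hS hSf
  have hlim : Tendsto (fun k : ℕ => ENNReal.ofReal (2 * B * volume.real S ^ s) +
      ENNReal.ofReal (A₀ / 2 ^ k * volume.real S ^ s₀)) atTop
      (𝓝 (ENNReal.ofReal (2 * B * volume.real S ^ s) + ENNReal.ofReal (0 * volume.real S ^ s₀))) := by
    refine Tendsto.add tendsto_const_nhds (ENNReal.tendsto_ofReal (Tendsto.mul_const _ ?_))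
    exact tendsto_const_nhds.div_atTop (tendsto_pow_atTop_atTop_of_one_lt one_lt_two)
  rw [zero_mul, ENNReal.ofReal_zero, add_zero] at hlim
  refine ge_of_tendsto' hlim fun k => ?_
  obtain ⟨a, b, ha, hb, hwa, hwb, hab⟩ := key k
  calc ∫⁻ x in S, u x ≤ ∫⁻ x in S, (a x + b x) := lintegral_mono_ae (ae_restrict_of_ae hab)
    _ = (∫⁻ x in S, a x) + ∫⁻ x in S, b x := lintegral_add_left ha _
    _ ≤ _ := add_le_add (hwa S hS hSf) (hwb S hS hSf)

/-- The operator `w ↦ I (V w)` is bounded on a weak space, with norm controlled by `‖V‖_{L^n}`. -/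
theorem exists_weakBound_rieszPotential_mul (hn : 2 ≤ n) {s : ℝ} (hs1 : s < 1) (hs : 1 / (n : ℝ) < s) :
    ∃ C : ℝ, 0 < C ∧ ∀ (A ε : ℝ) (V f : Euc n → ℝ≥0∞), 0 < A → 0 < ε → Measurable f → Measurable V →
      WeakBound s A f → ∫⁻ x, V x ^ (n : ℝ) ≤ ENNReal.ofReal (ε ^ (n : ℝ)) →
      WeakBound s (C * ε * A) (rieszPotential fun x => V x * f x) := by
  have hn' : (2 : ℝ) ≤ n := by exact_mod_cast hn
  obtain ⟨C₁, hC₁, h₁⟩ := exists_weakBound_mul (α := Euc n) (d := n) (by linarith) hs1 hs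
  obtain ⟨C₂, hC₂, h₂⟩ := exists_weakBound_rieszPotential hn (s := s - 1 / n) (by linarith) (by linarith)
  refine ⟨C₂ * C₁, by positivity, fun A ε V f hA hε hf hV hw hVε => ?_⟩
  have := h₂ _ _ (by positivity) (hV.mul hf) (h₁ A ε V f hA hε hf hV hw hVε)
  rw [sub_add_cancel, show C₂ * (C₁ * ε * A) = C₂ * C₁ * ε * A by ring] at this
  exact this

/-- The integral of `g` over `{u > k}` tends to zero as `k` grows. -/
theorem exists_lintegral_indicator_le {α : Type*} [MeasureSpace α] {g u : α → ℝ≥0∞} (hg : Measurable g)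
    (hu : Measurable u) (hgf : ∫⁻ x, g x ≠ ⊤) (hut : ∀ᵐ x, u x < ⊤) {ε : ℝ≥0∞} (hε : 0 < ε) :
    ∃ k : ℕ, ∫⁻ x, {x | (k : ℝ≥0∞) < u x}.indicator g x ≤ ε := by
  have h : Tendsto (fun k : ℕ => ∫⁻ x, {x | (k : ℝ≥0∞) < u x}.indicator g x) atTop
      (𝓝 (∫⁻ _ : α, 0)) := by
    refine tendsto_lintegral_of_dominated_convergence g
      (fun k => hg.indicator (measurableSet_lt measurable_const hu)) (fun k => ?_) hgf ?_
    · exact Eventually.of_forall fun x => indicator_le_self _ _ x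
    · filter_upwards [hut] with x hx
      refine tendsto_const_nhds.congr' ?_
      obtain ⟨N, hN⟩ := ENNReal.exists_nat_gt hx.ne
      filter_upwards [eventually_ge_atTop N] with k hk
      rw [indicator_of_notMem]
      simp only [mem_ofPred_eq, not_lt]
      exact hN.le.trans (by exact_mod_cast hk)
  rw [lintegral_zero] at h
  exact ((h.eventually (gt_mem_nhds hε)).exists).imp fun k hk => hk.le

/-- Truncation of the critical nonlinearity: the potential of its bounded part is bounded. -/
theorem exists_rieszPotential_truncation_le (hn : 2 ≤ n) {u : Euc n → ℝ≥0∞} (hu : Measurable u)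
    (hp : ∫⁻ x, u x ^ (2 * (n : ℝ) / (n - 1)) ≠ ⊤) (k : ℕ) :
    ∃ M : ℝ, 0 < M ∧ ∀ x, rieszPotential
      ({x | u x ≤ k}.indicator fun x => u x ^ (((n : ℝ) + 1) / (n - 1))) x ≤ ENNReal.ofReal M := by
  have hn' : (2 : ℝ) ≤ n := by exact_mod_cast hn
  have h1 : (0 : ℝ) < n - 1 := by linarith
  have : NeZero n := ⟨by omega⟩
  obtain ⟨M, hM, hfar⟩ := exists_lintegral_compl_ball_le hn hu hp
  obtain ⟨C, hC, hnear⟩ := exists_lintegral_ball_riesz_kernel_le (n := n) (b := (n : ℝ) - 1) (by linarith)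
  set q := ((n : ℝ) + 1) / (n - 1) with hq
  have hq0 : 0 < q := by positivity
  refine ⟨C * (k : ℝ) ^ q + M, by positivity, fun x => ?_⟩
  unfold rieszPotential
  rw [← lintegral_add_compl _ (measurableSet_ball (x := x) (ε := 1)),
    ENNReal.ofReal_add (by positivity) hM.le]
  refine add_le_add ?_ ?_
  · calc _ ≤ ∫⁻ y in ball x 1, ‖x - y‖ₑ ^ (-((n : ℝ) - 1)) * ENNReal.ofReal ((k : ℝ) ^ q) := by
          refine lintegral_mono fun y => mul_le_mul_right ?_ _
          refine indicator_apply_le' (fun hy => ?_) (fun _ => zero_le)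
          rw [← ENNReal.ofReal_rpow_of_nonneg (by positivity) hq0.le, ENNReal.ofReal_natCast]
          exact ENNReal.rpow_le_rpow hy hq0.le
      _ ≤ ENNReal.ofReal (C * 1 ^ ((n : ℝ) - (n - 1))) * ENNReal.ofReal ((k : ℝ) ^ q) := by
          rw [lintegral_mul_const' _ _ ENNReal.ofReal_ne_top]
          gcongr
          exact hnear x 1 one_pos
      _ = _ := by rw [Real.one_rpow, mul_one, ← ENNReal.ofReal_mul hC.le]
  · refine le_trans (lintegral_mono fun y => mul_le_mul_right ?_ _) (hfar x)
    exact indicator_le_self _ _ y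

/-- Regularity in weak spaces for subsolutions of the critical equation `u = C I (u ^ q)`. -/
theorem exists_weakBound_of_critical (hn : 2 ≤ n) {u : Euc n → ℝ≥0∞} (hu : Measurable u)
    (hp : ∫⁻ x, u x ^ (2 * (n : ℝ) / (n - 1)) ≠ ⊤) {C : ℝ} (hC : 0 < C)
    (h : ∀ᵐ x, u x ≤ ENNReal.ofReal C * rieszPotential (fun y => u y ^ (((n : ℝ) + 1) / (n - 1))) x)
    {s : ℝ} (hs1 : s < 1) (hs : 1 - 1 / (2 * (n : ℝ) / (n - 1)) ≤ s) :
    ∃ A : ℝ, 0 < A ∧ WeakBound s A u := by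
  have hn' : (2 : ℝ) ≤ n := by exact_mod_cast hn
  have h1 : (0 : ℝ) < n - 1 := by linarith
  set p := 2 * (n : ℝ) / (n - 1) with hpdef
  set q := ((n : ℝ) + 1) / (n - 1) with hq
  have hp1 : 1 < p := by rw [hpdef, lt_div_iff₀ h1]; linarith
  set s₀ := 1 - 1 / p with hs₀
  have hs₀1 : s₀ < 1 := by
    have : 0 < 1 / p := by positivity
    linarith
  have hs₀n : 1 / (n : ℝ) < s₀ := by
    rw [hs₀, hpdef, one_div_div, div_lt_iff₀ (by linarith), sub_mul, div_mul_eq_mul_div,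
      lt_sub_iff_add_lt, add_comm, ← lt_sub_iff_add_lt, div_lt_iff₀ (by linarith)]
    nlinarith
  -- the function `u` lies in the large weak space
  set A₀ := (∫⁻ x, u x ^ p).toReal ^ (1 / p) + 1 with hA₀
  have hA₀0 : 0 < A₀ := by positivity
  have huA : WeakBound s₀ A₀ u :=
    weakBound_of_lintegral_rpow_le hp1 hA₀0 hu (le_ofReal_rpow_toReal_add_one hp (by positivity))
  have hut : ∀ᵐ x, u x < ⊤ := huA.ae_lt_top hu
  obtain ⟨C₁, hC₁, hT₁⟩ := exists_weakBound_rieszPotential_mul hn hs1 (hs₀n.trans_le hs)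
  obtain ⟨C₂, hC₂, hT₂⟩ := exists_weakBound_rieszPotential_mul hn hs₀1 hs₀n
  set V : Euc n → ℝ≥0∞ := fun x => ENNReal.ofReal C * u x ^ (2 / ((n : ℝ) - 1)) with hV
  have hVm : Measurable V := (hu.pow_const _).const_mul _
  have hVn : ∀ x, V x ^ (n : ℝ) = ENNReal.ofReal (C ^ (n : ℝ)) * u x ^ p := by
    intro x
    simp only [hV]
    rw [ENNReal.mul_rpow_of_nonneg _ _ (by positivity), ENNReal.ofReal_rpow_of_pos hC, ← ENNReal.rpow_mul]
    congr 2
    rw [hpdef]; ring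
  have hVf : ∫⁻ x, V x ^ (n : ℝ) ≠ ⊤ := by
    simp only [hVn]
    rw [lintegral_const_mul' _ _ ENNReal.ofReal_ne_top]
    exact ENNReal.mul_ne_top ENNReal.ofReal_ne_top hp
  have hVu : ∀ x, V x * u x = ENNReal.ofReal C * u x ^ q := by
    intro x
    have : q = 2 / ((n : ℝ) - 1) + 1 := by rw [hq]; field_simp; ring
    rw [this, ENNReal.rpow_add_of_nonneg _ _ (by positivity) zero_le_one, ENNReal.rpow_one, ← mul_assoc]
  set ε := min (1 / (2 * C₁)) (1 / (2 * C₂)) with hε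
  have hε0 : 0 < ε := by positivity
  have hε₁ : C₁ * ε ≤ 1 / 2 := by
    calc C₁ * ε ≤ C₁ * (1 / (2 * C₁)) := by gcongr; exact min_le_left _ _
      _ = _ := by field_simp
  have hε₂ : C₂ * ε ≤ 1 / 2 := by
    calc C₂ * ε ≤ C₂ * (1 / (2 * C₂)) := by gcongr; exact min_le_right _ _
      _ = _ := by field_simp
  -- the part of the potential over the set where `u` is large is small in `L^n`
  obtain ⟨k, hk⟩ := exists_lintegral_indicator_le (hVm.pow_const (n : ℝ)) hu hVf hut
    (ε := ENNReal.ofReal (ε ^ (n : ℝ))) (by positivity)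
  set V₁ : Euc n → ℝ≥0∞ := {x | (k : ℝ≥0∞) < u x}.indicator V with hV₁
  have hV₁m : Measurable V₁ := hVm.indicator (measurableSet_lt measurable_const hu)
  have hV₁ε : ∫⁻ x, V₁ x ^ (n : ℝ) ≤ ENNReal.ofReal (ε ^ (n : ℝ)) := by
    refine le_trans (le_of_eq (lintegral_congr fun x => ?_)) hk
    by_cases hx : x ∈ {x | (k : ℝ≥0∞) < u x}
    · rw [hV₁, indicator_of_mem hx, indicator_of_mem hx]
    · rw [hV₁, indicator_of_notMem hx, indicator_of_notMem hx, ENNReal.zero_rpow_of_pos (by positivity)]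
  set G : Euc n → ℝ≥0∞ := {x | u x ≤ k}.indicator fun x => u x ^ q with hG
  have hGm : Measurable G := (hu.pow_const _).indicator (measurableSet_le hu measurable_const)
  set F : Euc n → ℝ≥0∞ := rieszPotential fun x => ENNReal.ofReal C * G x with hF
  have hFm : Measurable F := measurable_rieszPotential (hGm.const_mul _)
  obtain ⟨M, hM, hGM⟩ := exists_rieszPotential_truncation_le hn hu hp k
  have hFM : ∀ x, F x ≤ ENNReal.ofReal (C * M) := by
    intro x
    rw [hF, rieszPotential_const_mul ENNReal.ofReal_ne_top, ENNReal.ofReal_mul hC.le]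
    gcongr
    exact hGM x
  -- the remaining part is bounded and in the large weak space, hence in all smaller ones
  obtain ⟨B, hB, hFB⟩ : ∃ B : ℝ, 0 < B ∧ WeakBound s₀ B F := by
    set ε' := (∫⁻ x, V x ^ (n : ℝ)).toReal ^ (1 / (n : ℝ)) + 1 with hε'
    have hε'0 : 0 < ε' := by positivity
    have hVε : ∫⁻ x, V x ^ (n : ℝ) ≤ ENNReal.ofReal (ε' ^ (n : ℝ)) :=
      le_ofReal_rpow_toReal_add_one hVf (by positivity)
    refine ⟨C₂ * ε' * A₀, by positivity, (hT₂ A₀ ε' V u hA₀0 hε'0 hu hVm huA hVε).mono ?_⟩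
    refine Eventually.of_forall fun x => rieszPotential_mono (Eventually.of_forall fun y => ?_) x
    simp only [hVu]
    gcongr
    exact indicator_le_self _ _ y
  have hFs : WeakBound s (B + C * M) F :=
    hFB.interpolate hFM hB.le (by positivity) hs hs1.le
  refine ⟨2 * (B + C * M), by positivity, ?_⟩
  refine weakBound_of_contraction (T := fun w => rieszPotential fun x => V₁ x * w x) (s₀ := s₀)
    (A₀ := A₀) (F := F) ?_ ?_ ?_ ?_ ?_ hu hFm (by positivity) hA₀0 ?_ hFs huA
  · exact fun w hw => measurable_rieszPotential (hV₁m.mul hw)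
  · intro w v hwv x
    refine rieszPotential_mono ?_ x
    filter_upwards [hwv] with y hy
    gcongr
  · intro w v hw x
    simp only [mul_add]
    exact rieszPotential_add (hV₁m.mul hw) x
  · intro A w hA hw hwA
    exact (hT₁ A ε V₁ w hA hε0 hw hV₁m hwA hV₁ε).mono_const (by nlinarith)
  · intro A w hA hw hwA
    exact (hT₂ A ε V₁ w hA hε0 hw hV₁m hwA hV₁ε).mono_const (by nlinarith)
  · filter_upwards [h] with x hx
    refine hx.trans (le_of_eq ?_)
    rw [← rieszPotential_const_mul ENNReal.ofReal_ne_top, hF, ← rieszPotential_add (f := fun y => V₁ y * u y) (hV₁m.mul hu)]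
    congr 1
    funext y
    by_cases hy : (k : ℝ≥0∞) < u y
    · rw [hV₁, hG, indicator_of_mem (by exact hy), indicator_of_notMem (by simpa using hy), mul_zero,
        add_zero, hVu]
    · rw [hV₁, hG, indicator_of_notMem (by exact hy), indicator_of_mem (by simpa using hy), zero_mul,
        zero_add]

/-- Subsolutions of the critical integral equation are bounded. -/
theorem exists_ae_le_of_critical (hn : 2 ≤ n) {u : Euc n → ℝ≥0∞} (hu : Measurable u)
    (hp : ∫⁻ x, u x ^ (2 * (n : ℝ) / (n - 1)) ≠ ⊤) {C : ℝ} (hC : 0 < C)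
    (h : ∀ᵐ x, u x ≤ ENNReal.ofReal C * rieszPotential (fun y => u y ^ (((n : ℝ) + 1) / (n - 1))) x) :
    ∃ M : ℝ, 0 < M ∧ ∀ᵐ x, u x ≤ ENNReal.ofReal M := by
  have hn' : (2 : ℝ) ≤ n := by exact_mod_cast hn
  have h1 : (0 : ℝ) < n - 1 := by linarith
  have : NeZero n := ⟨by omega⟩
  have : Nonempty (Fin n) := ⟨0⟩
  set q := ((n : ℝ) + 1) / (n - 1) with hq
  have hq0 : 0 < q := by positivity
  -- the kernel is locally in `L^b` for some `b > 1`, with conjugate exponent `b'`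
  set b := (2 * (n : ℝ) - 1) / (2 * n - 2) with hb
  set b' := 2 * (n : ℝ) - 1 with hb'
  have hb0 : 0 < b := div_pos (by linarith) (by linarith)
  have hb'0 : 0 < b' := by rw [hb']; linarith
  have hbb : b.HolderConjugate b' := by
    rw [Real.holderConjugate_iff]
    constructor
    · rw [hb, lt_div_iff₀ (by linarith)]; linarith
    · rw [hb, hb']
      have : 2 * (n : ℝ) - 2 ≠ 0 := by linarith
      have : 2 * (n : ℝ) - 1 ≠ 0 := by linarith
      field_simp; ring
  set a := q * b' with ha
  have ha0 : 0 < a := by positivity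
  set s := max (1 - 1 / (2 * (n : ℝ) / (n - 1))) (1 - 1 / (2 * a)) with hs
  have hs1 : s < 1 := by
    refine max_lt ?_ ?_
    · have : 0 < 1 / (2 * (n : ℝ) / (n - 1)) := by positivity
      linarith
    · have : 0 < 1 / (2 * a) := by positivity
      linarith
  have has : a * (1 - s) < 1 := by
    have : 1 - s ≤ 1 / (2 * a) := by linarith [le_max_right (1 - 1 / (2 * (n : ℝ) / (n - 1))) (1 - 1 / (2 * a))]
    calc a * (1 - s) ≤ a * (1 / (2 * a)) := by gcongr
      _ = 1 / 2 := by field_simp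
      _ < 1 := by norm_num
  obtain ⟨A, hA, huA⟩ := exists_weakBound_of_critical hn hu hp hC h hs1 (le_max_left _ _)
  obtain ⟨C₁, hC₁, hpow⟩ := exists_lintegral_rpow_le_of_weakBound (α := Euc n) hs1 ha0 has
  obtain ⟨M, hM, hfar⟩ := exists_lintegral_compl_ball_le hn hu hp
  obtain ⟨C₂, hC₂, hnear⟩ :=
    exists_lintegral_ball_riesz_kernel_le (n := n) (b := ((n : ℝ) - 1) * b) (by
      rw [hb, mul_div_assoc', div_lt_iff₀ (by linarith)]; nlinarith)
  set m := (volume : Measure (Euc n)).real (ball 0 1) with hm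
  set R := (C₂ * 1 ^ ((n : ℝ) - (n - 1) * b)) ^ (1 / b) *
    (C₁ * A ^ a * m ^ (1 - a * (1 - s))) ^ (1 / b') with hR
  have hR0 : 0 ≤ R := by positivity
  refine ⟨C * (R + M), by positivity, ?_⟩
  filter_upwards [h] with x hx
  refine hx.trans ?_
  rw [ENNReal.ofReal_mul hC.le]
  gcongr
  unfold rieszPotential
  rw [← lintegral_add_compl _ (measurableSet_ball (x := x) (ε := 1)), ENNReal.ofReal_add hR0 hM.le]
  refine add_le_add ?_ (hfar x)
  have hvol : (volume : Measure (Euc n)).real (ball x 1) = m := by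
    rw [hm, measureReal_def, measureReal_def, Measure.addHaar_ball_center]
  calc _ ≤ (∫⁻ y in ball x 1, (‖x - y‖ₑ ^ (-((n : ℝ) - 1))) ^ b) ^ (1 / b) *
        (∫⁻ y in ball x 1, (u y ^ q) ^ b') ^ (1 / b') :=
        ENNReal.lintegral_mul_le_Lp_mul_Lq _ hbb (by fun_prop) (hu.pow_const _).aemeasurable
    _ ≤ (ENNReal.ofReal (C₂ * 1 ^ ((n : ℝ) - (n - 1) * b))) ^ (1 / b) *
        (ENNReal.ofReal (C₁ * A ^ a * m ^ (1 - a * (1 - s)))) ^ (1 / b') := by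
        gcongr
        · simp only [← ENNReal.rpow_mul, neg_mul]
          exact hnear x 1 one_pos
        · simp only [← ENNReal.rpow_mul]
          rw [← hvol]
          exact hpow A u _ hA hu huA measurableSet_ball measure_ball_lt_top.ne
            (measure_ball_pos _ _ one_pos).ne'
    _ = _ := by
        rw [ENNReal.ofReal_rpow_of_nonneg (by positivity) (by positivity),
          ENNReal.ofReal_rpow_of_nonneg (by positivity) (by positivity),
          ← ENNReal.ofReal_mul (by positivity)]

end Critical

/-! ### Inversion in the unit sphere and decay -/

section Kelvin
open EuclideanGeometry
variable {n : ℕ}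

theorem norm_inversion (x : Euc n) : ‖inversion (0 : Euc n) 1 x‖ = ‖x‖⁻¹ := by
  have := dist_inversion_center (0 : Euc n) x 1
  simpa [dist_zero_right] using this

theorem ae_ne_point [NeZero n] (a : Euc n) : ∀ᵐ x : Euc n, x ≠ a := by
  have : Nonempty (Fin n) := ⟨0⟩
  simp [ae_iff, measure_singleton]

theorem measurable_inversion : Measurable (inversion (0 : Euc n) 1) := by
  have : inversion (0 : Euc n) 1 = fun x => (1 / ‖x‖) ^ 2 • x := by
    funext x; simp [inversion]
  rw [this]
  fun_prop

theorem image_inversion_compl_singleton :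
    inversion (0 : Euc n) 1 '' {0}ᶜ = {0}ᶜ := by
  ext x
  simp only [mem_image, mem_compl_iff, mem_singleton_iff]
  constructor
  · rintro ⟨y, hy, rfl⟩
    rwa [inversion_eq_center one_ne_zero]
  · intro hx
    exact ⟨inversion 0 1 x, by rwa [inversion_eq_center one_ne_zero],
      inversion_inversion _ one_ne_zero _⟩

/-- Change of variables under `x ↦ x / |x| ^ 2`, whose Jacobian is `|x| ^ (-2 n)`. -/
theorem lintegral_comp_inversion [NeZero n] (F : Euc n → ℝ≥0∞) :
    ∫⁻ x, ‖x‖ₑ ^ (-(2 * n : ℝ)) * F (inversion 0 1 x) = ∫⁻ x, F x := by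
  have hae : ({0}ᶜ : Set (Euc n)) =ᵐ[volume] univ := by
    rw [ae_eq_univ, compl_compl]
    have : Nonempty (Fin n) := ⟨0⟩
    exact measure_singleton 0
  have h := lintegral_image_eq_lintegral_abs_det_fderiv_mul (volume : Measure (Euc n))
    (f := inversion (0 : Euc n) 1) (measurableSet_singleton (0 : Euc n)).compl
    (fun x hx => (hasFDerivAt_inversion (c := (0 : Euc n)) (R := 1) hx).hasFDerivWithinAt)
    (inversion_injective _ one_ne_zero).injOn F
  rw [image_inversion_compl_singleton, Measure.restrict_congr_set hae, Measure.restrict_univ] at h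
  rw [h]
  refine lintegral_congr_ae ?_
  filter_upwards [ae_ne_point (0 : Euc n)] with x hx
  congr 1
  have hx0 : 0 < ‖x‖ := norm_pos_iff.2 hx
  rw [← ofReal_norm, ENNReal.ofReal_rpow_of_pos hx0]
  congr 1
  have hdet : ∀ (c : ℝ) (K : Submodule ℝ (Euc n)),
      |(c • (K.reflection : Euc n →L[ℝ] Euc n)).det| = |c| ^ n := by
    intro c K
    have h2 : |LinearMap.det K.reflection.toLinearMap| = 1 := by
      rw [K.det_reflection, abs_pow, abs_neg, abs_one, one_pow]
    have h3 : (c • (K.reflection : Euc n →L[ℝ] Euc n)).det =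
        LinearMap.det (c • K.reflection.toLinearMap) := rfl
    rw [h3, LinearMap.det_smul, abs_mul, h2, mul_one, abs_pow, finrank_euclideanSpace_fin]
  rw [hdet, dist_zero_right, abs_of_nonneg (by positivity), ← pow_mul, one_div, inv_pow,
    Real.rpow_neg hx0.le]
  congr 1
  exact_mod_cast (Real.rpow_natCast ‖x‖ (2 * n)).symm

/-- Inversion preserves null sets. -/
theorem ae_comp_inversion [NeZero n] {P : Euc n → Prop} (h : ∀ᵐ x, P x) :
    ∀ᵐ x, P (inversion (0 : Euc n) 1 x) := by
  obtain ⟨N, hN, hNm, hN0⟩ := exists_measurable_superset_of_null h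
  have h1 := lintegral_comp_inversion (N.indicator (1 : Euc n → ℝ≥0∞))
  rw [lintegral_indicator_one hNm, hN0, lintegral_eq_zero_iff] at h1
  · filter_upwards [h1, ae_ne_point (0 : Euc n)] with x hx hx0
    by_contra hP
    have hmem : inversion (0 : Euc n) 1 x ∈ N := hN hP
    simp only [indicator_of_mem hmem, Pi.one_apply, mul_one, Pi.zero_apply] at hx
    rw [ENNReal.rpow_eq_zero_iff] at hx
    rcases hx with ⟨h2, -⟩ | ⟨h2, -⟩
    · exact hx0 (by simpa using h2)
    · exact enorm_ne_top h2
  · exact Measurable.mul (by fun_prop) ((measurable_one.indicator hNm).comp measurable_inversion)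

/-- The Kelvin transform of conformal weight `n - 1`, under which the critical integral equation is
invariant. -/
noncomputable def kelvinTransform (u : Euc n → ℝ≥0∞) (x : Euc n) : ℝ≥0∞ :=
  ‖x‖ₑ ^ (-((n : ℝ) - 1)) * u (inversion 0 1 x)

theorem measurable_kelvinTransform {u : Euc n → ℝ≥0∞} (hu : Measurable u) :
    Measurable (kelvinTransform u) :=
  Measurable.mul (by fun_prop) (hu.comp measurable_inversion)

theorem lintegral_kelvinTransform_rpow (hn : 2 ≤ n) (u : Euc n → ℝ≥0∞) :
    ∫⁻ x, kelvinTransform u x ^ (2 * (n : ℝ) / (n - 1)) = ∫⁻ x, u x ^ (2 * (n : ℝ) / (n - 1)) := by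
  have hn' : (2 : ℝ) ≤ n := by exact_mod_cast hn
  have h1 : (0 : ℝ) < n - 1 := by linarith
  have : NeZero n := ⟨by omega⟩
  rw [← lintegral_comp_inversion (fun x => u x ^ (2 * (n : ℝ) / (n - 1)))]
  refine lintegral_congr fun x => ?_
  unfold kelvinTransform
  rw [ENNReal.mul_rpow_of_nonneg _ _ (by positivity), ← ENNReal.rpow_mul]
  congr 2
  field_simp

/-- Conformal covariance of the critical potential. It comes from the identity
`|x / |x|² - z / |z|²| = |x - z| / (|x| |z|)`, the powers of `|z|` cancelling for the exponent `q`. -/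
theorem rieszPotential_inversion (hn : 2 ≤ n) (u : Euc n → ℝ≥0∞) {x : Euc n} (hx : x ≠ 0) :
    rieszPotential (fun y => u y ^ (((n : ℝ) + 1) / (n - 1))) (inversion 0 1 x) =
      ‖x‖ₑ ^ ((n : ℝ) - 1) *
        rieszPotential (fun y => kelvinTransform u y ^ (((n : ℝ) + 1) / (n - 1))) x := by
  have hn' : (2 : ℝ) ≤ n := by exact_mod_cast hn
  have h1 : (0 : ℝ) < n - 1 := by linarith
  have : NeZero n := ⟨by omega⟩
  have hx0 : 0 < ‖x‖ := norm_pos_iff.2 hx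
  unfold rieszPotential
  rw [← lintegral_comp_inversion (fun y => ‖inversion 0 1 x - y‖ₑ ^ (-((n : ℝ) - 1)) *
    u y ^ (((n : ℝ) + 1) / (n - 1))), ← lintegral_const_mul' _ _
    (ENNReal.rpow_ne_top_of_nonneg h1.le enorm_ne_top)]
  refine lintegral_congr_ae ?_
  filter_upwards [ae_ne_point (0 : Euc n), ae_ne_point x] with z hz hzx
  have hz0 : 0 < ‖z‖ := norm_pos_iff.2 hz
  have hxz : 0 < ‖x - z‖ := norm_pos_iff.2 (sub_ne_zero.2 (Ne.symm hzx))
  have hd := dist_inversion_inversion (c := (0 : Euc n)) hx hz 1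
  rw [dist_eq_norm, dist_zero_right, dist_zero_right, dist_eq_norm] at hd
  have hpos : 0 < ‖inversion (0 : Euc n) 1 x - inversion 0 1 z‖ := by rw [hd]; positivity
  unfold kelvinTransform
  rw [ENNReal.mul_rpow_of_nonneg _ _ (by positivity)]
  simp only [← ofReal_norm, ENNReal.ofReal_rpow_of_pos hz0, ENNReal.ofReal_rpow_of_pos hx0,
    ENNReal.ofReal_rpow_of_pos hxz, ENNReal.ofReal_rpow_of_pos hpos]
  rw [ENNReal.ofReal_rpow_of_pos (by positivity), ← mul_assoc, ← mul_assoc, ← mul_assoc,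
    ← ENNReal.ofReal_mul (by positivity), ← ENNReal.ofReal_mul (by positivity),
    ← ENNReal.ofReal_mul (by positivity)]
  congr 2
  rw [hd, ← Real.rpow_mul hz0.le, Real.mul_rpow (by positivity) hxz.le,
    show (1 : ℝ) ^ 2 / (‖x‖ * ‖z‖) = (‖x‖ * ‖z‖)⁻¹ by simp, Real.inv_rpow (by positivity),
    ← Real.rpow_neg (by positivity), neg_neg, Real.mul_rpow hx0.le hz0.le]
  have e : -((n : ℝ) - 1) * ((n + 1) / (n - 1)) = -(2 * n) + (n - 1) := by field_simp; ring
  rw [e, Real.rpow_add hz0]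
  ring

/-- Subsolutions of the critical integral equation decay like the kernel. -/
theorem exists_ae_le_rpow_of_critical (hn : 2 ≤ n) {u : Euc n → ℝ≥0∞} (hu : Measurable u)
    (hp : ∫⁻ x, u x ^ (2 * (n : ℝ) / (n - 1)) ≠ ⊤) {C : ℝ} (hC : 0 < C)
    (h : ∀ᵐ x, u x ≤ ENNReal.ofReal C * rieszPotential (fun y => u y ^ (((n : ℝ) + 1) / (n - 1))) x) :
    ∃ M : ℝ, 0 < M ∧ ∀ᵐ x, u x ≤ ENNReal.ofReal M ∧
      u x ≤ ENNReal.ofReal (M * ‖x‖ ^ (-((n : ℝ) - 1))) := by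
  have hn' : (2 : ℝ) ≤ n := by exact_mod_cast hn
  have h1 : (0 : ℝ) < n - 1 := by linarith
  have : NeZero n := ⟨by omega⟩
  obtain ⟨M₁, hM₁, hb⟩ := exists_ae_le_of_critical hn hu hp hC h
  obtain ⟨M₂, hM₂, hk⟩ := exists_ae_le_of_critical hn (measurable_kelvinTransform hu)
    (by rwa [lintegral_kelvinTransform_rpow hn]) hC (by
      filter_upwards [ae_comp_inversion h, ae_ne_point (0 : Euc n)] with x hx hx0
      unfold kelvinTransform
      refine (mul_le_mul_right hx _).trans (le_of_eq ?_)
      have hx1 : ‖x‖ₑ ≠ 0 := by simpa using hx0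
      rw [rieszPotential_inversion hn u hx0, mul_left_comm, ← mul_assoc (‖x‖ₑ ^ (-((n : ℝ) - 1))),
        ← ENNReal.rpow_add _ _ hx1 enorm_ne_top, neg_add_cancel, ENNReal.rpow_zero, one_mul]
      rfl)
  refine ⟨max M₁ M₂, by positivity, ?_⟩
  filter_upwards [hb, ae_comp_inversion hk, ae_ne_point (0 : Euc n)] with x hx1 hx2 hx0
  have hxp : 0 < ‖x‖ := norm_pos_iff.2 hx0
  refine ⟨hx1.trans (ENNReal.ofReal_le_ofReal (le_max_left _ _)), ?_⟩
  unfold kelvinTransform at hx2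
  rw [inversion_inversion _ one_ne_zero, ← ofReal_norm, norm_inversion,
    ENNReal.ofReal_rpow_of_pos (by positivity), Real.inv_rpow hxp.le, ← Real.rpow_neg hxp.le,
    neg_neg] at hx2
  have e : ENNReal.ofReal (‖x‖ ^ (-((n : ℝ) - 1))) * ENNReal.ofReal (‖x‖ ^ ((n : ℝ) - 1)) = 1 := by
    rw [← ENNReal.ofReal_mul (by positivity), ← Real.rpow_add hxp, neg_add_cancel, Real.rpow_zero,
      ENNReal.ofReal_one]
  calc u x = ENNReal.ofReal (‖x‖ ^ (-((n : ℝ) - 1))) * (ENNReal.ofReal (‖x‖ ^ ((n : ℝ) - 1)) * u x) := by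
        rw [← mul_assoc, e, one_mul]
    _ ≤ ENNReal.ofReal (‖x‖ ^ (-((n : ℝ) - 1))) * ENNReal.ofReal M₂ := by gcongr
    _ ≤ _ := by
        rw [← ENNReal.ofReal_mul (by positivity), mul_comm]
        refine ENNReal.ofReal_le_ofReal ?_
        gcongr
        exact le_max_right _ _

end Kelvin

/-! ### Clifford multiplication and the Dirac operator on radial test functions -/

section Clifford
variable {n m : ℕ}

/-- Clifford multiplication `x ↦ ∑ⱼ xⱼ αⱼ`, as a real-linear map into the operators on spinors. -/
noncomputable def cliffordMul (α : Fin n → SpinorMatrix m) :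
    Euc n →L[ℝ] (Spinor m →L[ℂ] Spinor m) :=
  ∑ j, (EuclideanSpace.proj j : Euc n →L[ℝ] ℝ).smulRight (matOp (α j))

theorem cliffordMul_apply (α : Fin n → SpinorMatrix m) (x : Euc n) :
    cliffordMul α x = ∑ j, x j • matOp (α j) := by
  simp [cliffordMul]

theorem cliffordMul_apply_apply (α : Fin n → SpinorMatrix m) (x : Euc n) (v : Spinor m) :
    cliffordMul α x v = ∑ j, x j • matOp (α j) v := by
  rw [cliffordMul_apply]
  simp only [sum_apply, smul_apply]

theorem cliffordMul_single (α : Fin n → SpinorMatrix m) (j : Fin n) :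
    cliffordMul α (EuclideanSpace.single j 1) = matOp (α j) := by
  rw [cliffordMul_apply, Finset.sum_eq_single j]
  · simp
  · intro i _ hij
    rw [PiLp.single_apply, if_neg hij]
    exact zero_smul ℝ (matOp (α i))
  · simp

theorem matOp_mul (A B : SpinorMatrix m) (v : Spinor m) : matOp (A * B) v = matOp A (matOp B v) := by
  simp [matOp, map_mul]

theorem matOp_add (A B : SpinorMatrix m) : matOp (A + B) = matOp A + matOp B := by
  simp [matOp]

theorem matOp_apply_of_isClifford {α : Fin n → SpinorMatrix m} (hα : IsClifford α) (j k : Fin n)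
    (v : Spinor m) : matOp (α j) (matOp (α k) v) + matOp (α k) (matOp (α j) v) =
      if j = k then (2 : ℝ) • v else 0 := by
  rw [← matOp_mul, ← matOp_mul, ← add_apply, ← matOp_add, hα j k]
  split_ifs
  · have : matOp (2 : SpinorMatrix m) = 2 := map_ofNat _ 2
    rw [this, two_smul]
    exact congrArg (fun T : Spinor m →L[ℂ] Spinor m => T v) one_add_one_eq_two.symm
  · have : matOp (0 : SpinorMatrix m) = 0 := map_zero _
    rw [this]; rfl

theorem matOp_sq_of_isClifford {α : Fin n → SpinorMatrix m} (hα : IsClifford α) (j : Fin n)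
    (v : Spinor m) : matOp (α j) (matOp (α j) v) = v := by
  have h := matOp_apply_of_isClifford hα j j v
  rw [if_pos rfl, ← two_smul ℝ] at h
  exact smul_right_injective _ (two_ne_zero (α := ℝ)) h

theorem cliffordMul_cliffordMul {α : Fin n → SpinorMatrix m} (hα : IsClifford α) (x : Euc n)
    (v : Spinor m) : cliffordMul α x (cliffordMul α x v) = ‖x‖ ^ 2 • v := by
  have h1 : cliffordMul α x (cliffordMul α x v) =
      ∑ j, ∑ k, (x j * x k) • matOp (α j) (matOp (α k) v) := by
    rw [Finset.sum_comm]
    simp only [cliffordMul_apply, sum_apply, smul_apply, map_sum,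
      ContinuousLinearMap.map_smul_of_tower, smul_smul]
  have h2 : cliffordMul α x (cliffordMul α x v) =
      ∑ j, ∑ k, (x j * x k) • matOp (α k) (matOp (α j) v) := by
    rw [h1, Finset.sum_comm]
    simp only [mul_comm]
  have h3 : (2 : ℝ) • cliffordMul α x (cliffordMul α x v) = (2 : ℝ) • (‖x‖ ^ 2 • v) := by
    rw [two_smul]
    nth_rw 1 [h1]
    rw [h2, ← Finset.sum_add_distrib]
    simp only [← Finset.sum_add_distrib, ← smul_add, matOp_apply_of_isClifford hα, smul_ite, smul_zero,
      Finset.sum_ite_eq, Finset.mem_univ, if_true]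
    rw [← Finset.sum_smul, EuclideanSpace.real_norm_sq_eq, smul_comm]
    simp only [sq]
  exact smul_right_injective _ (two_ne_zero (α := ℝ)) h3

theorem adjoint_matOp (A : SpinorMatrix m) : ContinuousLinearMap.adjoint (matOp A) = matOp Aᴴ :=
  (map_star (Matrix.toEuclideanCLM (𝕜 := ℂ)) A).symm

theorem inner_cliffordMul_left {α : Fin n → SpinorMatrix m} (hH : ∀ j, (α j).IsHermitian) (x : Euc n)
    (v w : Spinor m) : inner ℂ (cliffordMul α x v) w = inner ℂ v (cliffordMul α x w) := by
  simp only [cliffordMul_apply, sum_apply, smul_apply, sum_inner,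
    inner_sum]
  refine Finset.sum_congr rfl fun j _ => ?_
  rw [inner_smul_left_eq_smul, inner_smul_right_eq_smul, ← ContinuousLinearMap.adjoint_inner_right,
    adjoint_matOp, hH j]

theorem isHermitian_diracMatrix (σ : Fin n → Matrix (Fin m) (Fin m) ℂ) (j : Fin n) :
    (diracMatrix σ j).IsHermitian := by
  unfold diracMatrix
  rw [Matrix.IsHermitian, Matrix.fromBlocks_conjTranspose]
  simp

/-- The test function `y ↦ κ(|y - x|²) (y - x) · v` for the Dirac operator. -/
noncomputable def radialSpinor (α : Fin n → SpinorMatrix m) (κ : ℝ → ℝ) (x : Euc n) (v : Spinor m)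
    (y : Euc n) : Spinor m :=
  κ (‖y - x‖ ^ 2) • cliffordMul α (y - x) v

theorem contDiff_radialSpinor (α : Fin n → SpinorMatrix m) {κ : ℝ → ℝ} (hκ : ContDiff ℝ ∞ κ)
    (x : Euc n) (v : Spinor m) : ContDiff ℝ ∞ (radialSpinor α κ x v) := by
  unfold radialSpinor
  refine ContDiff.smul (hκ.comp ((contDiff_id.sub contDiff_const).norm_sq ℝ)) ?_
  exact (((ContinuousLinearMap.apply ℂ (Spinor m) v).restrictScalars ℝ).comp
    (cliffordMul α)).contDiff.comp (contDiff_id.sub contDiff_const)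

theorem hasCompactSupport_radialSpinor (α : Fin n → SpinorMatrix m) {κ : ℝ → ℝ} {R : ℝ} (hR : 0 ≤ R)
    (hκ : ∀ s, R ^ 2 ≤ s → κ s = 0) (x : Euc n) (v : Spinor m) :
    HasCompactSupport (radialSpinor α κ x v) := by
  refine HasCompactSupport.intro (isCompact_closedBall x R) fun y hy => ?_
  have : R < ‖y - x‖ := by simpa [dist_eq_norm] using hy
  unfold radialSpinor
  rw [hκ _ (by gcongr), zero_smul]

/-- For radial test functions the Clifford relations reduce the Dirac operator to a scalar one. -/
theorem diracOp_radialSpinor {α : Fin n → SpinorMatrix m} (hα : IsClifford α) {κ : ℝ → ℝ}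
    (hκ : ContDiff ℝ ∞ κ) (x : Euc n) (v : Spinor m) (y : Euc n) :
    diracOp α (radialSpinor α κ x v) y = -Complex.I •
      ((2 * ‖y - x‖ ^ 2 * deriv κ (‖y - x‖ ^ 2) + n * κ (‖y - x‖ ^ 2)) • v) := by
  have h1 : HasFDerivAt (fun y : Euc n => y - x) (ContinuousLinearMap.id ℝ (Euc n)) y :=
    (hasFDerivAt_id y).sub_const x
  have h2 : HasFDerivAt (fun y : Euc n => κ (‖y - x‖ ^ 2)) (deriv κ (‖y - x‖ ^ 2) •
      (2 • (innerSL ℝ) (y - x) ∘SL ContinuousLinearMap.id ℝ (Euc n))) y :=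
    ((hκ.differentiable (by simp)).differentiableAt.hasDerivAt).comp_hasFDerivAt y h1.norm_sq
  have h3 : HasFDerivAt (fun y : Euc n => cliffordMul α (y - x) v) (((ContinuousLinearMap.apply ℂ (Spinor m) v).restrictScalars ℝ).comp (cliffordMul α)) y :=
    (((ContinuousLinearMap.apply ℂ (Spinor m) v).restrictScalars ℝ).comp
      (cliffordMul α)).hasFDerivAt.comp y h1
  have h4 := h2.smul h3
  have h5 : ∀ j, fderiv ℝ (radialSpinor α κ x v) y (EuclideanSpace.single j 1) =
      κ (‖y - x‖ ^ 2) • matOp (α j) v +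
        (2 * deriv κ (‖y - x‖ ^ 2)) • (y - x) j • cliffordMul α (y - x) v := by
    intro j
    have h6 : fderiv ℝ (radialSpinor α κ x v) y = _ := h4.fderiv
    rw [h6]
    simp [cliffordMul_single, smul_smul]
    rw [EuclideanSpace.inner_single_right, EuclideanSpace.inner_single_right]
    congr 1
    simp
    ring
  unfold diracOp
  congr 1
  simp only [h5, map_add, ContinuousLinearMap.map_smul_of_tower, matOp_sq_of_isClifford hα,
    Finset.sum_add_distrib, Finset.sum_const, ← Finset.smul_sum]
  have h7 : ∑ j, (y - x) j • matOp (α j) (cliffordMul α (y - x) v) = ‖y - x‖ ^ 2 • v := by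
    rw [← cliffordMul_apply_apply, cliffordMul_cliffordMul hα]
  rw [h7, Finset.card_univ, Fintype.card_fin, ← Nat.cast_smul_eq_nsmul ℝ, smul_smul, smul_smul, ← add_smul]
  congr 1
  ring

/-- The weak formulation tested with a radial spinor, where the Dirac operator acts as an ordinary
differential operator on the profile `κ`. -/
theorem IsWeakSolution.integral_radialSpinor {α : Fin n → SpinorMatrix m} (hα : IsClifford α)
    (hH : ∀ j, (α j).IsHermitian) {h : Euc n → Spinor m → SpinorMatrix m} {ψ : Euc n → Spinor m}
    (hψ : IsWeakSolution α h ψ) {κ : ℝ → ℝ} (hκ : ContDiff ℝ ∞ κ) {R : ℝ} (hR : 0 ≤ R)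
    (hκR : ∀ s, R ^ 2 ≤ s → κ s = 0) (x : Euc n)
    (h₁ : Integrable fun y => (2 * ‖y - x‖ ^ 2 * deriv κ (‖y - x‖ ^ 2) + n * κ (‖y - x‖ ^ 2)) • ψ y)
    (h₂ : Integrable fun y => κ (‖y - x‖ ^ 2) • cliffordMul α (y - x) (matOp (h y (ψ y)) (ψ y))) :
    Complex.I • ∫ y, (2 * ‖y - x‖ ^ 2 * deriv κ (‖y - x‖ ^ 2) + n * κ (‖y - x‖ ^ 2)) • ψ y =
      ∫ y, κ (‖y - x‖ ^ 2) • cliffordMul α (y - x) (matOp (h y (ψ y)) (ψ y)) := by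
  refine ext_inner_left ℂ fun v => ?_
  have hw := hψ.weak_eq (radialSpinor α κ x v) (contDiff_radialSpinor α hκ x v)
    (hasCompactSupport_radialSpinor α hR hκR x v)
  rw [← integral_inner h₂, inner_smul_right, ← integral_inner h₁, ← integral_const_mul]
  refine Eq.trans (integral_congr_ae (Eventually.of_forall fun y => ?_))
    (hw.trans (integral_congr_ae (Eventually.of_forall fun y => ?_)))
  · simp only [diracOp_radialSpinor hα hκ]
    rw [inner_smul_left, inner_smul_left_eq_smul, inner_smul_right_eq_smul]
    simp
  · simp only [radialSpinor]
    rw [inner_smul_left_eq_smul, inner_smul_right_eq_smul, inner_cliffordMul_left hH]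

end Clifford

/-! ### Smooth truncations of the fundamental solution -/

section Profile

/-- A smooth monotone function, equal to `0` on `(-∞, 1/2]` and to `1` on `[1, ∞)`. -/
noncomputable def cutoff (s : ℝ) : ℝ := Real.smoothTransition (2 * s - 1)

theorem contDiff_cutoff : ContDiff ℝ ∞ cutoff :=
  Real.smoothTransition.contDiff.comp ((contDiff_const.mul contDiff_id).sub contDiff_const)

theorem cutoff_of_le {s : ℝ} (hs : s ≤ 1 / 2) : cutoff s = 0 :=
  Real.smoothTransition.zero_of_nonpos (by linarith)

theorem cutoff_of_ge {s : ℝ} (hs : 1 ≤ s) : cutoff s = 1 :=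
  Real.smoothTransition.one_of_one_le (by linarith)

theorem cutoff_nonneg (s : ℝ) : 0 ≤ cutoff s := Real.smoothTransition.nonneg _

theorem cutoff_le_one (s : ℝ) : cutoff s ≤ 1 := Real.smoothTransition.le_one _

theorem monotone_cutoff : Monotone cutoff := fun a b hab =>
  Real.smoothTransition.monotone (by linarith)

/-- The profile of the kernel `x / |x| ^ n`, as a function of `s = |x| ^ 2`, smoothly cut off near the
origin. -/
noncomputable def kernelProfile (n : ℕ) (s : ℝ) : ℝ := s ^ (-((n : ℝ) / 2)) * cutoff s

/-- The divergence of `y ↦ κ(|y| ^ 2) y`, for `κ` the kernel profile, as a function of `s = |y| ^ 2`. -/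
noncomputable def massProfile (n : ℕ) (s : ℝ) : ℝ :=
  2 * s * deriv (kernelProfile n) s + n * kernelProfile n s

variable (n : ℕ)

theorem kernelProfile_of_le {s : ℝ} (hs : s ≤ 1 / 2) : kernelProfile n s = 0 := by
  rw [kernelProfile, cutoff_of_le hs, mul_zero]

theorem contDiff_kernelProfile : ContDiff ℝ ∞ (kernelProfile n) := by
  rw [contDiff_iff_contDiffAt]
  intro s
  rcases lt_or_ge s (1 / 2) with hs | hs
  · refine (contDiffAt_const (c := (0 : ℝ))).congr_of_eventuallyEq ?_
    filter_upwards [Iio_mem_nhds hs] with r hr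
    exact kernelProfile_of_le n (le_of_lt hr)
  · have : s ≠ 0 := by linarith
    exact (Real.contDiffAt_rpow_const_of_ne this).mul contDiff_cutoff.contDiffAt

theorem continuous_massProfile : Continuous (massProfile n) := by
  have h := (contDiff_kernelProfile n).continuous_deriv (by simp)
  have h' := (contDiff_kernelProfile n).continuous
  unfold massProfile
  fun_prop

theorem massProfile_of_pos {s : ℝ} (hs : 0 < s) :
    massProfile n s = 2 * s ^ (1 - (n : ℝ) / 2) * deriv cutoff s := by
  have h1 : HasDerivAt (fun r : ℝ => r ^ (-((n : ℝ) / 2))) _ s :=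
    Real.hasDerivAt_rpow_const (p := -((n : ℝ) / 2)) (Or.inl hs.ne')
  have h2 : HasDerivAt cutoff (deriv cutoff s) s :=
    (contDiff_cutoff.differentiable (by simp)).differentiableAt.hasDerivAt
  have h3 : deriv (kernelProfile n) s = _ := (h1.mul h2).deriv
  rw [massProfile, h3, kernelProfile, Real.rpow_sub_one hs.ne', sub_eq_add_neg (1 : ℝ),
    Real.rpow_add hs, Real.rpow_one]
  field_simp
  ring

theorem massProfile_of_lt {s : ℝ} (hs : s < 1 / 2) : massProfile n s = 0 := by
  have : deriv (kernelProfile n) s = 0 := by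
    rw [Filter.EventuallyEq.deriv_eq (f := fun _ => (0 : ℝ)), deriv_const]
    filter_upwards [Iio_mem_nhds hs] with r hr
    exact kernelProfile_of_le n (le_of_lt hr)
  rw [massProfile, this, kernelProfile_of_le n hs.le]; simp

theorem massProfile_of_gt {s : ℝ} (hs : 1 < s) : massProfile n s = 0 := by
  have : deriv cutoff s = 0 := by
    rw [Filter.EventuallyEq.deriv_eq (f := fun _ => (1 : ℝ)), deriv_const]
    filter_upwards [Ioi_mem_nhds hs] with r hr
    exact cutoff_of_ge (le_of_lt hr)
  rw [massProfile_of_pos n (by linarith), this, mul_zero]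

theorem massProfile_nonneg (s : ℝ) : 0 ≤ massProfile n s := by
  rcases lt_or_ge s (1 / 2) with hs | hs
  · rw [massProfile_of_lt n hs]
  · have : 0 < s := by linarith
    rw [massProfile_of_pos n this]
    have := monotone_cutoff.deriv_nonneg (x := s)
    positivity

theorem exists_massProfile_pos : ∃ s : ℝ, 0 < s ∧ 0 < massProfile n s := by
  obtain ⟨s, hs, h⟩ := exists_deriv_eq_slope cutoff (a := 1 / 2) (b := 1) (by norm_num)
    contDiff_cutoff.continuous.continuousOn (contDiff_cutoff.differentiable (by simp)).differentiableOn
  have hs0 : 0 < s := by linarith [hs.1]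
  refine ⟨s, hs0, ?_⟩
  rw [massProfile_of_pos n hs0, h, cutoff_of_ge le_rfl, cutoff_of_le le_rfl]
  norm_num
  positivity

theorem exists_massProfile_le : ∃ B : ℝ, 0 < B ∧ ∀ s, |massProfile n s| ≤ B := by
  have hc : HasCompactSupport (massProfile n) := by
    refine HasCompactSupport.intro (isCompact_Icc (a := (1 / 2 : ℝ)) (b := 1)) fun s hs => ?_
    rcases lt_or_ge s (1 / 2) with h | h
    · exact massProfile_of_lt n h
    · exact massProfile_of_gt n (not_le.1 fun h' => hs ⟨h, h'⟩)
  obtain ⟨B, hB⟩ := hc.exists_bound_of_continuous (continuous_massProfile n)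
  exact ⟨max B 1, by positivity, fun s => (hB s).trans (le_max_left _ _)⟩

/-- The profile of the kernel `x / |x| ^ n`, as a function of `s = |x| ^ 2`, smoothly cut off at the
radii `t` and `T`. -/
noncomputable def truncatedProfile (t T s : ℝ) : ℝ :=
  (t ^ n)⁻¹ * kernelProfile n (s / t ^ 2) - (T ^ n)⁻¹ * kernelProfile n (s / T ^ 2)

theorem contDiff_truncatedProfile (t T : ℝ) : ContDiff ℝ ∞ (truncatedProfile n t T) := by
  unfold truncatedProfile
  have h : ∀ r : ℝ, ContDiff ℝ ∞ fun s => (r ^ n)⁻¹ * kernelProfile n (s / r ^ 2) := fun r =>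
    contDiff_const.mul ((contDiff_kernelProfile n).comp (contDiff_id.div_const _))
  exact (h t).sub (h T)

/-- The divergence of the truncated kernel is the difference of two rescaled bumps of equal mass. -/
theorem truncatedProfile_divergence (t T s : ℝ) :
    2 * s * deriv (truncatedProfile n t T) s + n * truncatedProfile n t T s =
      (t ^ n)⁻¹ * massProfile n (s / t ^ 2) - (T ^ n)⁻¹ * massProfile n (s / T ^ 2) := by
  have h : ∀ r : ℝ, HasDerivAt (fun s => (r ^ n)⁻¹ * kernelProfile n (s / r ^ 2))
      ((r ^ n)⁻¹ * (deriv (kernelProfile n) (s / r ^ 2) * (1 / r ^ 2))) s := fun r => by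
    have h1 : HasDerivAt (kernelProfile n) (deriv (kernelProfile n) (s / r ^ 2)) (s / r ^ 2) :=
      ((contDiff_kernelProfile n).differentiable (by simp)).differentiableAt.hasDerivAt
    exact (h1.comp s ((hasDerivAt_id s).div_const (r ^ 2))).const_mul _
  have h2 : deriv (truncatedProfile n t T) s = _ := ((h t).sub (h T)).deriv
  rw [h2, truncatedProfile, massProfile, massProfile]
  ring

theorem truncatedProfile_eq {t T s : ℝ} (ht : 0 < t) (hT : 0 < T) (hs : 0 < s) :
    truncatedProfile n t T s =
      s ^ (-((n : ℝ) / 2)) * (cutoff (s / t ^ 2) - cutoff (s / T ^ 2)) := by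
  have h : ∀ r : ℝ, 0 < r → (r ^ n)⁻¹ * kernelProfile n (s / r ^ 2) =
      s ^ (-((n : ℝ) / 2)) * cutoff (s / r ^ 2) := fun r hr => by
    rw [kernelProfile, Real.div_rpow hs.le (by positivity), ← Real.rpow_natCast r 2, ← Real.rpow_mul hr.le,
      show ((2 : ℕ) : ℝ) * -((n : ℝ) / 2) = -n by push_cast; ring, Real.rpow_neg hr.le, Real.rpow_natCast]
    field_simp
  rw [truncatedProfile, h t ht, h T hT]
  ring

theorem truncatedProfile_of_ge {t T s : ℝ} (ht : 0 < t) (htT : t ≤ T) (hs : T ^ 2 ≤ s) :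
    truncatedProfile n t T s = 0 := by
  have hT : 0 < T := ht.trans_le htT
  have hs0 : 0 < s := lt_of_lt_of_le (by positivity) hs
  rw [truncatedProfile_eq n ht hT hs0, cutoff_of_ge, cutoff_of_ge, sub_self, mul_zero]
  · rw [le_div_iff₀ (by positivity)]; linarith
  · rw [le_div_iff₀ (by positivity), one_mul]
    exact le_trans (by gcongr) hs

theorem abs_truncatedProfile_le {t T s : ℝ} (ht : 0 < t) (hT : 0 < T) (hs : 0 < s) :
    |truncatedProfile n t T s| ≤ s ^ (-((n : ℝ) / 2)) := by
  rw [truncatedProfile_eq n ht hT hs, abs_mul, abs_of_pos (by positivity)]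
  refine mul_le_of_le_one_right (by positivity) (abs_le.2 ⟨?_, ?_⟩)
  · linarith [cutoff_nonneg (s / t ^ 2), cutoff_le_one (s / T ^ 2)]
  · linarith [cutoff_nonneg (s / T ^ 2), cutoff_le_one (s / t ^ 2)]

theorem tendsto_truncatedProfile {s : ℝ} (hs : 0 < s) :
    Tendsto (fun k : ℕ => truncatedProfile n ((k : ℝ) + 1)⁻¹ ((k : ℝ) + 1) s) atTop
      (𝓝 (s ^ (-((n : ℝ) / 2)))) := by
  refine tendsto_const_nhds.congr' ?_
  obtain ⟨N, hN⟩ := exists_nat_gt (max (1 / s) (2 * s))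
  filter_upwards [eventually_ge_atTop N] with k hk
  have hk' : (N : ℝ) ≤ k := by exact_mod_cast hk
  have h1 : 1 / s < (k : ℝ) + 1 := by linarith [le_max_left (1 / s) (2 * s)]
  have h2 : 2 * s < (k : ℝ) + 1 := by linarith [le_max_right (1 / s) (2 * s)]
  have h3 : (1 : ℝ) ≤ (k : ℝ) + 1 := by linarith [Nat.cast_nonneg (α := ℝ) k]
  have h4 : (k : ℝ) + 1 ≤ ((k : ℝ) + 1) ^ 2 := by nlinarith
  rw [truncatedProfile_eq n (by positivity) (by positivity) hs, cutoff_of_ge, cutoff_of_le, sub_zero,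
    mul_one]
  · rw [div_le_div_iff₀ (by positivity) (by norm_num)]; linarith
  · rw [inv_pow, div_inv_eq_mul]
    rw [div_lt_iff₀ hs] at h1
    nlinarith

end Profile

/-! ### The integral representation of weak solutions -/

section Representation
variable {n m : ℕ}

/-- The total mass of the divergence of the truncated kernel, which is the constant of the
fundamental solution. -/
noncomputable def kernelMass (n : ℕ) : ℝ := ∫ z : Euc n, massProfile n (‖z‖ ^ 2)

theorem kernelMass_pos [NeZero n] : 0 < kernelMass n := by
  obtain ⟨s, hs, h⟩ := exists_massProfile_pos n
  have hcont : Continuous fun z : Euc n => massProfile n (‖z‖ ^ 2) :=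
    (continuous_massProfile n).comp (by fun_prop)
  refine Continuous.integral_pos_of_hasCompactSupport_nonneg_nonzero (μ := volume)
    (x := EuclideanSpace.single (0 : Fin n) (√s)) hcont ?_ (fun z => massProfile_nonneg n _) ?_
  · refine HasCompactSupport.intro (isCompact_closedBall (0 : Euc n) 1) fun z hz => ?_
    refine massProfile_of_gt n ?_
    have : 1 < ‖z‖ := by simpa using hz
    nlinarith
  · rw [PiLp.norm_single, Real.norm_of_nonneg (by positivity), Real.sq_sqrt hs.le]
    exact h.ne'

theorem integral_massProfile (x : Euc n) {t : ℝ} (ht : 0 < t) :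
    ∫ y : Euc n, (t ^ n)⁻¹ * massProfile n (‖y - x‖ ^ 2 / t ^ 2) = kernelMass n := by
  rw [integral_sub_right_eq_self (fun y : Euc n => (t ^ n)⁻¹ * massProfile n (‖y‖ ^ 2 / t ^ 2)) x,
    integral_const_mul]
  have h := Measure.integral_comp_smul (volume : Measure (Euc n)) (fun y => massProfile n (‖y‖ ^ 2)) t⁻¹
  rw [finrank_euclideanSpace_fin, inv_pow, inv_inv, abs_of_pos (by positivity)] at h
  have h2 : ∀ y : Euc n, massProfile n (‖y‖ ^ 2 / t ^ 2) = massProfile n (‖t⁻¹ • y‖ ^ 2) := fun y => by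
    rw [norm_smul, Real.norm_of_nonneg (by positivity), mul_pow, inv_pow]
    congr 1
    ring
  simp only [h2]
  rw [h, kernelMass, smul_eq_mul, ← mul_assoc, inv_mul_cancel₀ (by positivity), one_mul]

theorem support_massProfile_subset (x : Euc n) {t : ℝ} (ht : 0 < t) :
    Function.support (fun y : Euc n => (t ^ n)⁻¹ * massProfile n (‖y - x‖ ^ 2 / t ^ 2)) ⊆
      closedBall x t := by
  intro y hy
  by_contra hyt
  have : t < ‖y - x‖ := by simpa [dist_eq_norm] using hyt
  refine hy ?_
  simp only
  rw [massProfile_of_gt, mul_zero]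
  rw [lt_div_iff₀ (by positivity), one_mul]
  gcongr

variable {F : Type*} [NormedAddCommGroup F] [NormedSpace ℝ F]

theorem integrable_massProfile_smul {ψ : Euc n → F} (hψ : LocallyIntegrable ψ) (x : Euc n) {t : ℝ}
    (ht : 0 < t) :
    Integrable fun y => ((t ^ n)⁻¹ * massProfile n (‖y - x‖ ^ 2 / t ^ 2)) • ψ y := by
  refine hψ.integrable_smul_left_of_hasCompactSupport ?_ ?_
  · exact continuous_const.mul ((continuous_massProfile n).comp (by fun_prop))
  · exact HasCompactSupport.of_support_subset_isCompact (isCompact_closedBall x t)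
      (support_massProfile_subset x ht)

/-- The bumps of radius `1 / (k + 1)` converge to a multiple of the Dirac mass. -/
theorem ae_tendsto_integral_massProfile [NeZero n] [CompleteSpace F] {ψ : Euc n → F}
    (hψ : LocallyIntegrable ψ) :
    ∀ᵐ x, Tendsto (fun k : ℕ => ∫ y, ((((k : ℝ) + 1)⁻¹ ^ n)⁻¹ *
      massProfile n (‖y - x‖ ^ 2 / ((k : ℝ) + 1)⁻¹ ^ 2)) • ψ y) atTop (𝓝 (kernelMass n • ψ x)) := by
  have hc := kernelMass_pos (n := n)
  obtain ⟨B, hB, hBle⟩ := exists_massProfile_le n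
  filter_upwards [(Besicovitch.vitaliFamily (volume : Measure (Euc n))).ae_tendsto_average_norm_sub hψ]
    with x hx
  have ht : Tendsto (fun k : ℕ => ((k : ℝ) + 1)⁻¹) atTop (𝓝[>] 0) :=
    tendsto_nhdsWithin_iff.2 ⟨by
      simpa [one_div] using tendsto_one_div_add_atTop_nhds_zero_nat (𝕜 := ℝ),
      Eventually.of_forall fun k => by simp only [mem_Ioi]; positivity⟩
  have h1 := (hx.comp (Besicovitch.tendsto_filterAt volume x)).comp ht
  set ν := (volume : Measure (Euc n)).real (ball 0 1) with hν
  have hν0 : 0 < ν := ENNReal.toReal_pos (measure_ball_pos _ _ one_pos).ne' measure_ball_lt_top.ne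
  have h2 := tendsto_integral_smul_of_tendsto_average_norm_sub (μ := (volume : Measure (Euc n)))
    (a := fun k : ℕ => closedBall x ((k : ℝ) + 1)⁻¹) (f := ψ) (c := ψ x)
    (g := fun (k : ℕ) y => (kernelMass n)⁻¹ * ((((k : ℝ) + 1)⁻¹ ^ n)⁻¹ *
      massProfile n (‖y - x‖ ^ 2 / ((k : ℝ) + 1)⁻¹ ^ 2))) ((kernelMass n)⁻¹ * B * ν) h1
    (Eventually.of_forall fun k => hψ.integrableOn_isCompact (isCompact_closedBall _ _)) ?_ ?_ ?_
  · have h3 := h2.const_smul (kernelMass n)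
    refine h3.congr fun k => ?_
    rw [← integral_smul]
    refine integral_congr_ae (Eventually.of_forall fun y => ?_)
    simp only [smul_smul]
    rw [← mul_assoc, mul_inv_cancel₀ hc.ne', one_mul]
  · refine tendsto_const_nhds.congr fun k => ?_
    rw [integral_const_mul, integral_massProfile x (by positivity), inv_mul_cancel₀ hc.ne']
  · refine Eventually.of_forall fun k y hy => ?_
    exact support_massProfile_subset x (t := ((k : ℝ) + 1)⁻¹) (by positivity) (right_ne_zero_of_mul hy)
  · refine Eventually.of_forall fun k y => ?_
    set t := ((k : ℝ) + 1)⁻¹ with htdef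
    have ht0 : 0 < t := by positivity
    rw [Measure.addHaar_real_closedBall _ _ ht0.le, finrank_euclideanSpace_fin, abs_mul, abs_mul,
      abs_of_pos (inv_pos.2 hc), abs_of_pos (by positivity : 0 < (t ^ n)⁻¹), ← hν]
    calc (kernelMass n)⁻¹ * ((t ^ n)⁻¹ * |massProfile n (‖y - x‖ ^ 2 / t ^ 2)|)
        ≤ (kernelMass n)⁻¹ * ((t ^ n)⁻¹ * B) := by gcongr; exact hBle _
      _ = _ := by field_simp

/-- The bumps of radius `k + 1` disappear in the limit, for `ψ` in a weak Lebesgue space. -/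
theorem tendsto_integral_massProfile_zero [NeZero n] {ψ : Euc n → F} {s A : ℝ} (hs : s < 1)
    (hw : WeakBound s A fun x => ‖ψ x‖ₑ) (hA : 0 ≤ A) (x : Euc n) :
    Tendsto (fun k : ℕ => ∫ y, ((((k : ℝ) + 1) ^ n)⁻¹ *
      massProfile n (‖y - x‖ ^ 2 / ((k : ℝ) + 1) ^ 2)) • ψ y) atTop (𝓝 0) := by
  obtain ⟨B, hB, hBle⟩ := exists_massProfile_le n
  set ν := (volume : Measure (Euc n)).real (ball 0 1) with hν
  have hν0 : 0 < ν := ENNReal.toReal_pos (measure_ball_pos _ _ one_pos).ne' measure_ball_lt_top.ne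
  have hn : 0 < (n : ℝ) := by exact_mod_cast NeZero.pos n
  have hlim : Tendsto (fun k : ℕ => B * A * ν ^ s * ((k : ℝ) + 1) ^ (-((n : ℝ) * (1 - s)))) atTop
      (𝓝 (B * A * ν ^ s * 0)) := by
    refine Tendsto.const_mul _ ((tendsto_rpow_neg_atTop (mul_pos hn (by linarith))).comp ?_)
    exact tendsto_atTop_add_const_right _ _ tendsto_natCast_atTop_atTop
  rw [mul_zero] at hlim
  refine squeeze_zero_norm (fun k => ?_) hlim
  set T := (k : ℝ) + 1 with hT
  have hT0 : 0 < T := by positivity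
  have hvol : (volume : Measure (Euc n)).real (closedBall x T) = T ^ n * ν := by
    rw [Measure.addHaar_real_closedBall _ _ hT0.le, finrank_euclideanSpace_fin]
  have hfin : volume (closedBall x T) ≠ ⊤ := measure_closedBall_lt_top.ne
  have h1 : ‖∫ y, ((T ^ n)⁻¹ * massProfile n (‖y - x‖ ^ 2 / T ^ 2)) • ψ y‖ₑ ≤
      ENNReal.ofReal ((T ^ n)⁻¹ * B) * ∫⁻ y in closedBall x T, ‖ψ y‖ₑ := by
    refine (enorm_integral_le_lintegral_enorm _).trans ?_
    rw [← lintegral_const_mul' _ _ ENNReal.ofReal_ne_top, ← lintegral_indicator measurableSet_closedBall]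
    refine lintegral_mono fun y => ?_
    by_cases hy : y ∈ closedBall x T
    · rw [indicator_of_mem hy, enorm_smul, ← ofReal_norm (_ * _)]
      gcongr
      rw [norm_mul, Real.norm_of_nonneg (by positivity)]
      gcongr
      exact hBle _
    · have : (T ^ n)⁻¹ * massProfile n (‖y - x‖ ^ 2 / T ^ 2) = 0 :=
        Function.notMem_support.1 fun h => hy (support_massProfile_subset x hT0 h)
      rw [this, zero_smul, enorm_zero]
      exact zero_le
  have h2 := h1.trans (mul_le_mul_right (hw _ measurableSet_closedBall hfin) _)
  rw [← ENNReal.ofReal_mul (by positivity), hvol, ← ofReal_norm,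
    ENNReal.ofReal_le_ofReal_iff (by positivity)] at h2
  refine h2.trans (le_of_eq ?_)
  rw [Real.mul_rpow (by positivity) hν0.le, ← Real.rpow_natCast, ← Real.rpow_mul hT0.le,
    ← Real.rpow_neg hT0.le, show -((n : ℝ) * (1 - s)) = -n + n * s by ring, Real.rpow_add hT0]
  ring

end Representation

/-! ### The Dirac kernel -/

section DiracKernel
variable {n m : ℕ}

theorem pow_sub_pow_le_mul {a b : ℝ} (ha : 0 ≤ a) (hab : a ≤ b) (k : ℕ) :
    b ^ (k + 1) - a ^ (k + 1) ≤ (k + 1) * b ^ k * (b - a) := by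
  induction k with
  | zero => simp
  | succ k ih =>
    have h1 : b ^ (k + 1 + 1) - a ^ (k + 1 + 1) = b * (b ^ (k + 1) - a ^ (k + 1)) + a ^ (k + 1) * (b - a) := by
      ring
    have hb : 0 ≤ b := ha.trans hab
    have h2 : a ^ (k + 1) ≤ b ^ (k + 1) := by gcongr
    have h3 := mul_le_mul_of_nonneg_left ih hb
    have h4 := mul_le_mul_of_nonneg_right h2 (sub_nonneg.2 hab)
    rw [h1]
    push_cast
    calc _ ≤ b * ((k + 1) * b ^ k * (b - a)) + b ^ (k + 1) * (b - a) := add_le_add h3 h4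
      _ = _ := by ring

theorem norm_inv_pow_smul_sub_le {E : Type*} [NormedAddCommGroup E] [NormedSpace ℝ E] {z w : E}
    (hn : 2 ≤ n) (hz : z ≠ 0) (hzw : ‖z‖ ≤ ‖w‖) :
    ‖(‖z‖ ^ n)⁻¹ • z - (‖w‖ ^ n)⁻¹ • w‖ ≤ (n + 1) * ‖z - w‖ * (‖z‖ ^ n)⁻¹ := by
  obtain ⟨k, rfl⟩ : ∃ k, n = k + 1 := ⟨n - 1, by omega⟩
  have hz0 : 0 < ‖z‖ := norm_pos_iff.2 hz
  have hw0 : 0 < ‖w‖ := hz0.trans_le hzw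
  set a := ‖z‖ with ha
  set b := ‖w‖ with hb
  have hba : b - a ≤ ‖z - w‖ := by rw [norm_sub_rev]; exact norm_sub_norm_le _ _
  have e : (a ^ (k + 1))⁻¹ • z - (b ^ (k + 1))⁻¹ • w =
      (b ^ (k + 1))⁻¹ • (z - w) + ((a ^ (k + 1))⁻¹ - (b ^ (k + 1))⁻¹) • z := by
    rw [smul_sub, sub_smul]; abel
  have hinv : (b ^ (k + 1))⁻¹ ≤ (a ^ (k + 1))⁻¹ := by gcongr
  rw [e]
  refine (norm_add_le _ _).trans ?_
  rw [norm_smul, norm_smul, Real.norm_of_nonneg (by positivity), Real.norm_of_nonneg (sub_nonneg.2 hinv),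
    ← ha]
  have h1 : (b ^ (k + 1))⁻¹ * ‖z - w‖ ≤ (a ^ (k + 1))⁻¹ * ‖z - w‖ := by gcongr
  have h2 : ((a ^ (k + 1))⁻¹ - (b ^ (k + 1))⁻¹) * a ≤ (k + 1) * ‖z - w‖ * (a ^ (k + 1))⁻¹ := by
    have h3 : (a ^ (k + 1))⁻¹ - (b ^ (k + 1))⁻¹ =
        (b ^ (k + 1) - a ^ (k + 1)) * ((a ^ (k + 1))⁻¹ * (b ^ (k + 1))⁻¹) := by field_simp
    rw [h3]
    calc _ ≤ ((k + 1) * b ^ k * ‖z - w‖) * ((a ^ (k + 1))⁻¹ * (b ^ (k + 1))⁻¹) * a := by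
          gcongr
          exact (pow_sub_pow_le_mul hz0.le hzw k).trans (by gcongr)
      _ = (k + 1) * ‖z - w‖ * (a ^ (k + 1))⁻¹ * (a / b) := by
          rw [pow_succ b]; field_simp
      _ ≤ _ := mul_le_of_le_one_right (by positivity) ((div_le_one hw0).2 hzw)
  push_cast
  linarith

/-- The fundamental solution of the Dirac operator, up to a constant factor. -/
noncomputable def diracKernel (α : Fin n → SpinorMatrix m) (z : Euc n) : Spinor m →L[ℂ] Spinor m :=
  cliffordMul α ((‖z‖ ^ n)⁻¹ • z)

theorem enorm_diracKernel_apply_le [NeZero n] (α : Fin n → SpinorMatrix m) (z : Euc n) (v : Spinor m) :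
    ‖diracKernel α z v‖ₑ ≤ ‖cliffordMul α‖ₑ * (‖z‖ₑ ^ (-((n : ℝ) - 1)) * ‖v‖ₑ) := by
  rcases eq_or_ne z 0 with rfl | hz
  · simp [diracKernel]
  have hz0 : 0 < ‖z‖ := norm_pos_iff.2 hz
  calc ‖diracKernel α z v‖ₑ ≤ ‖diracKernel α z‖ₑ * ‖v‖ₑ := ContinuousLinearMap.le_opENorm _ _
    _ ≤ ‖cliffordMul α‖ₑ * ‖(‖z‖ ^ n)⁻¹ • z‖ₑ * ‖v‖ₑ := by
        gcongr; exact ContinuousLinearMap.le_opENorm _ _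
    _ = _ := by
        rw [mul_assoc]
        congr 2
        rw [← ofReal_norm, ← ofReal_norm z, ENNReal.ofReal_rpow_of_pos hz0, norm_smul,
          Real.norm_of_nonneg (by positivity)]
        congr 1
        rw [show -((n : ℝ) - 1) = -n + 1 by ring, Real.rpow_add hz0, Real.rpow_one,
          Real.rpow_neg hz0.le, Real.rpow_natCast]

/-- Hölder continuity of the kernel away from its pole, with the scaling of the kernel. -/
theorem exists_enorm_diracKernel_sub_le (hn : 2 ≤ n) (α : Fin n → SpinorMatrix m) :
    ∃ C : ℝ, 0 < C ∧ ∀ (a : ℝ), 0 ≤ a → a ≤ 1 → ∀ (z w : Euc n), z ≠ 0 → w ≠ 0 → ∀ v : Spinor m,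
      ‖diracKernel α z v - diracKernel α w v‖ₑ ≤ ENNReal.ofReal C * ‖z - w‖ₑ ^ a *
        ((‖z‖ₑ ^ (-((n : ℝ) - 1 + a)) + ‖w‖ₑ ^ (-((n : ℝ) - 1 + a))) * ‖v‖ₑ) := by
  have : NeZero n := ⟨by omega⟩
  refine ⟨(n + 1) * (‖cliffordMul α‖ + 1), by positivity, fun a ha0 ha1 => ?_⟩
  -- it suffices to treat the case where `z` is closer to the pole
  have key : ∀ z w : Euc n, z ≠ 0 → w ≠ 0 → ‖z‖ ≤ ‖w‖ → ∀ v : Spinor m,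
      ‖diracKernel α z v - diracKernel α w v‖ₑ ≤ ENNReal.ofReal ((n + 1) * (‖cliffordMul α‖ + 1)) *
        ‖z - w‖ₑ ^ a * (‖z‖ₑ ^ (-((n : ℝ) - 1 + a)) * ‖v‖ₑ) := by
    intro z w hz hw hzw v
    have hz0 : 0 < ‖z‖ := norm_pos_iff.2 hz
    have hw0 : 0 < ‖w‖ := norm_pos_iff.2 hw
    have hvec : ‖(‖z‖ ^ n)⁻¹ • z - (‖w‖ ^ n)⁻¹ • w‖ ≤
        (n + 1) * ‖z - w‖ ^ a * ‖z‖ ^ (-((n : ℝ) - 1 + a)) := by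
      have e0 : ‖z‖ ^ (-((n : ℝ) - 1 + a)) = (‖z‖ ^ n)⁻¹ * ‖z‖ ^ (1 - a) := by
        rw [show -((n : ℝ) - 1 + a) = -n + (1 - a) by ring, Real.rpow_add hz0, Real.rpow_neg hz0.le,
          Real.rpow_natCast]
      rw [e0]
      rcases le_total ‖z - w‖ ‖z‖ with h | h
      · refine (norm_inv_pow_smul_sub_le hn hz hzw).trans ?_
        have : ‖z - w‖ ≤ ‖z - w‖ ^ a * ‖z‖ ^ (1 - a) := by
          rcases (norm_nonneg (z - w)).eq_or_lt with h0 | h0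
          · rw [← h0]; positivity
          calc ‖z - w‖ = ‖z - w‖ ^ a * ‖z - w‖ ^ (1 - a) := by
                rw [← Real.rpow_add h0]; simp
            _ ≤ _ := by gcongr
        calc _ ≤ (n + 1) * (‖z - w‖ ^ a * ‖z‖ ^ (1 - a)) * (‖z‖ ^ n)⁻¹ := by gcongr
          _ = _ := by ring
      · have hnorm : ∀ y : Euc n, 0 < ‖y‖ → ‖(‖y‖ ^ n)⁻¹ • y‖ = (‖y‖ ^ (n - 1))⁻¹ := fun y hy => by
          rw [norm_smul, Real.norm_of_nonneg (by positivity)]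
          obtain ⟨k, rfl⟩ : ∃ k, n = k + 1 := ⟨n - 1, by omega⟩
          rw [add_tsub_cancel_right, pow_succ]
          field_simp
        refine (norm_sub_le _ _).trans ?_
        rw [hnorm z hz0, hnorm w hw0]
        have h1 : (‖w‖ ^ (n - 1))⁻¹ ≤ (‖z‖ ^ (n - 1))⁻¹ := by gcongr
        have h2 : (‖z‖ ^ (n - 1))⁻¹ ≤ ‖z - w‖ ^ a * ((‖z‖ ^ n)⁻¹ * ‖z‖ ^ (1 - a)) := by
          calc (‖z‖ ^ (n - 1))⁻¹ = ‖z‖ ^ a * ((‖z‖ ^ n)⁻¹ * ‖z‖ ^ (1 - a)) := by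
                rw [mul_left_comm, ← Real.rpow_add hz0, add_sub_cancel, Real.rpow_one]
                obtain ⟨k, rfl⟩ : ∃ k, n = k + 1 := ⟨n - 1, by omega⟩
                rw [add_tsub_cancel_right, pow_succ]
                field_simp
            _ ≤ _ := by gcongr
        have h3 : (2 : ℝ) ≤ n + 1 := by
          have : (2 : ℝ) ≤ n := by exact_mod_cast hn
          linarith
        have h4 : 0 < (‖z‖ ^ (n - 1))⁻¹ := by positivity
        rw [mul_assoc]
        nlinarith
    calc ‖diracKernel α z v - diracKernel α w v‖ₑ
        = ‖cliffordMul α ((‖z‖ ^ n)⁻¹ • z - (‖w‖ ^ n)⁻¹ • w) v‖ₑ := by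
          rw [map_sub]; rfl
      _ ≤ ‖cliffordMul α‖ₑ * ‖(‖z‖ ^ n)⁻¹ • z - (‖w‖ ^ n)⁻¹ • w‖ₑ * ‖v‖ₑ := by
          refine (ContinuousLinearMap.le_opENorm _ _).trans ?_
          gcongr
          exact ContinuousLinearMap.le_opENorm _ _
      _ ≤ ENNReal.ofReal (‖cliffordMul α‖ + 1) *
          ENNReal.ofReal ((n + 1) * ‖z - w‖ ^ a * ‖z‖ ^ (-((n : ℝ) - 1 + a))) * ‖v‖ₑ := by
          rw [← ofReal_norm (cliffordMul α), ← ofReal_norm (_ - _)]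
          gcongr
          linarith
      _ = _ := by
          rw [← ofReal_norm (z - w), ← ofReal_norm z, ENNReal.ofReal_rpow_of_pos hz0,
            ENNReal.ofReal_rpow_of_nonneg (norm_nonneg _) ha0, ← mul_assoc,
            ← ENNReal.ofReal_mul (by positivity), ← ENNReal.ofReal_mul (by positivity),
            ← ENNReal.ofReal_mul (by positivity)]
          congr 2
          ring
  intro z w hz hw v
  rcases le_total ‖z‖ ‖w‖ with h | h
  · refine (key z w hz hw h v).trans ?_
    gcongr
    exact le_self_add
  · rw [← enorm_neg, neg_sub, ← enorm_neg (z - w), neg_sub]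
    refine (key w z hw hz h v).trans ?_
    gcongr
    exact le_add_self

end DiracKernel

/-! ### Potentials of functions with polynomial decay -/

section Decay
variable {n : ℕ}

/-- Potentials of integrable powers of `1 + |y|` are bounded, and decay like the kernel. -/
theorem exists_lintegral_riesz_kernel_decay_le [NeZero n] {b r : ℝ} (hb0 : 0 ≤ b) (hb : b < n)
    (hr : (n : ℝ) < r) :
    ∃ C : ℝ, 0 < C ∧ ∀ x : Euc n,
      ∫⁻ y, ‖x - y‖ₑ ^ (-b) * ENNReal.ofReal ((1 + ‖y‖) ^ (-r)) ≤ ENNReal.ofReal C ∧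
      (1 ≤ ‖x‖ → ∫⁻ y, ‖x - y‖ₑ ^ (-b) * ENNReal.ofReal ((1 + ‖y‖) ^ (-r)) ≤
        ENNReal.ofReal (C * ‖x‖ ^ (-b))) := by
  have hr0 : 0 < r := lt_of_le_of_lt (Nat.cast_nonneg n) hr
  have hJ := finite_integral_one_add_norm (μ := (volume : Measure (Euc n))) (r := r) (by simpa using hr)
  set J := ∫⁻ y : Euc n, ENNReal.ofReal ((1 + ‖y‖) ^ (-r)) with hJdef
  obtain ⟨C, hC, h⟩ := exists_lintegral_ball_riesz_kernel_le (n := n) hb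
  -- splitting at the distance `ρ` from the pole, with `B` a bound for the density close to the pole
  have key : ∀ (x : Euc n) (ρ B : ℝ), 0 < ρ → 0 ≤ B → (∀ y ∈ ball x ρ, (1 + ‖y‖) ^ (-r) ≤ B) →
      ∫⁻ y, ‖x - y‖ₑ ^ (-b) * ENNReal.ofReal ((1 + ‖y‖) ^ (-r)) ≤
        ENNReal.ofReal (C * ρ ^ (n - b) * B + ρ ^ (-b) * J.toReal) := by
    intro x ρ B hρ hB hle
    rw [← lintegral_add_compl _ (measurableSet_ball (x := x) (ε := ρ)),
      ENNReal.ofReal_add (by positivity) (by positivity)]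
    refine add_le_add ?_ ?_
    · rw [ENNReal.ofReal_mul (by positivity)]
      refine le_trans (setLIntegral_mono' measurableSet_ball (g := fun y => ‖x - y‖ₑ ^ (-b) *
        ENNReal.ofReal B) fun y hy => ?_) ?_
      · gcongr
        exact hle y hy
      · rw [lintegral_mul_const' _ _ ENNReal.ofReal_ne_top]
        gcongr
        exact h x ρ hρ
    · rw [ENNReal.ofReal_mul (by positivity), ENNReal.ofReal_toReal hJ.ne]
      refine le_trans (setLIntegral_mono' measurableSet_ball.compl (g := fun y =>
        ENNReal.ofReal (ρ ^ (-b)) * ENNReal.ofReal ((1 + ‖y‖) ^ (-r))) fun y hy => ?_) ?_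
      · gcongr
        have hy1 : ρ ≤ ‖x - y‖ := by
          simpa [mem_ball, dist_eq_norm, norm_sub_rev] using hy
        rw [← ofReal_norm, ENNReal.ofReal_rpow_of_pos (hρ.trans_le hy1)]
        exact ENNReal.ofReal_le_ofReal (Real.rpow_le_rpow_of_nonpos hρ hy1 (by linarith))
      · rw [lintegral_const_mul' _ _ ENNReal.ofReal_ne_top]
        gcongr
        exact setLIntegral_le_lintegral _ _
  have h2r : (0 : ℝ) < 2 ^ r := by positivity
  refine ⟨C + J.toReal + (C * 2 ^ r + 2 ^ b * J.toReal), by positivity, fun x => ⟨?_, fun hx => ?_⟩⟩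
  · refine (key x 1 1 one_pos zero_le_one fun y _ =>
      Real.rpow_le_one_of_one_le_of_nonpos (by linarith [norm_nonneg y]) (by linarith)).trans ?_
    refine ENNReal.ofReal_le_ofReal ?_
    rw [Real.one_rpow, Real.one_rpow]
    have : 0 ≤ C * 2 ^ r + 2 ^ b * J.toReal := by positivity
    linarith
  · have hx0 : 0 < ‖x‖ := by linarith
    refine (key x (‖x‖ / 2) ((‖x‖ / 2) ^ (-r)) (by positivity) (by positivity) fun y hy => ?_).trans ?_
    · refine Real.rpow_le_rpow_of_nonpos (by positivity) ?_ (by linarith)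
      have h1 : ‖x - y‖ < ‖x‖ / 2 := by simpa [dist_eq_norm, norm_sub_rev] using hy
      have h2 := norm_sub_norm_le x y
      linarith
    · refine ENNReal.ofReal_le_ofReal ?_
      have e1 : (‖x‖ / 2) ^ (-b) = 2 ^ b * ‖x‖ ^ (-b) := by
        rw [Real.div_rpow hx0.le (by norm_num), Real.rpow_neg (by norm_num : (0 : ℝ) ≤ 2), div_inv_eq_mul,
          mul_comm]
      have e2 : (‖x‖ / 2) ^ (n - b) * (‖x‖ / 2) ^ (-r) ≤ 2 ^ r * ‖x‖ ^ (-b) := by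
        rw [← Real.rpow_add (by positivity), Real.div_rpow hx0.le (by norm_num), div_eq_mul_inv,
          ← Real.rpow_neg (by norm_num), mul_comm]
        gcongr
        · norm_num
        · linarith
        · linarith
      have h3 : 0 ≤ ‖x‖ ^ (-b) := by positivity
      calc C * (‖x‖ / 2) ^ (n - b) * (‖x‖ / 2) ^ (-r) + (‖x‖ / 2) ^ (-b) * J.toReal
          ≤ C * (2 ^ r * ‖x‖ ^ (-b)) + 2 ^ b * ‖x‖ ^ (-b) * J.toReal := by
            rw [e1, mul_assoc C]
            gcongr
        _ = (C * 2 ^ r + 2 ^ b * J.toReal) * ‖x‖ ^ (-b) := by ring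
        _ ≤ _ := by
            refine mul_le_mul_of_nonneg_right ?_ h3
            have : 0 ≤ J.toReal := ENNReal.toReal_nonneg
            linarith

end Decay

/-! ### The Dirac potential -/

section DiracPotential
variable {n m : ℕ}

theorem aestronglyMeasurable_diracKernel_apply (α : Fin n → SpinorMatrix m) {g : Euc n → Euc n}
    (hg : Measurable g) {f : Euc n → Spinor m} (hf : AEStronglyMeasurable f) :
    AEStronglyMeasurable fun y => diracKernel α (g y) (f y) := by
  have h1 : Measurable fun y => (‖g y‖ ^ n)⁻¹ • g y := by fun_prop
  have h2 : AEStronglyMeasurable fun y => cliffordMul α ((‖g y‖ ^ n)⁻¹ • g y) :=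
    (cliffordMul α).continuous.comp_aestronglyMeasurable h1.aestronglyMeasurable
  exact (isBoundedBilinearMap_apply (𝕜 := ℂ) (E := Spinor m) (F := Spinor m)).continuous
    |>.comp_aestronglyMeasurable (h2.prodMk hf)

theorem integrable_diracKernel_apply [NeZero n] (α : Fin n → SpinorMatrix m) {f : Euc n → Spinor m}
    (hf : AEStronglyMeasurable f) {x : Euc n} (hx : rieszPotential (fun y => ‖f y‖ₑ) x < ⊤) :
    Integrable fun y => diracKernel α (x - y) (f y) := by
  refine ⟨aestronglyMeasurable_diracKernel_apply α (by fun_prop) hf, ?_⟩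
  refine lt_of_le_of_lt (lintegral_mono fun y => enorm_diracKernel_apply_le α (x - y) (f y)) ?_
  rw [lintegral_const_mul' _ _ enorm_ne_top]
  exact ENNReal.mul_lt_top enorm_lt_top hx

/-- The convolution of a spinor field with the fundamental solution of the Dirac operator. -/
noncomputable def diracPotential (α : Fin n → SpinorMatrix m) (f : Euc n → Spinor m) (x : Euc n) :
    Spinor m :=
  (Complex.I * ((kernelMass n)⁻¹ : ℝ)) • ∫ y, diracKernel α (x - y) (f y)

theorem enorm_I_mul_inv_kernelMass [NeZero n] :
    ‖Complex.I * (((kernelMass n)⁻¹ : ℝ) : ℂ)‖ₑ = ENNReal.ofReal (kernelMass n)⁻¹ := by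
  have hc := kernelMass_pos (n := n)
  rw [← ofReal_norm, norm_mul, Complex.norm_I, one_mul, Complex.norm_real,
    Real.norm_of_nonneg (by positivity)]

theorem enorm_diracPotential_le [NeZero n] (α : Fin n → SpinorMatrix m) (f : Euc n → Spinor m)
    (x : Euc n) : ‖diracPotential α f x‖ₑ ≤
      ENNReal.ofReal ((kernelMass n)⁻¹ * ‖cliffordMul α‖) * rieszPotential (fun y => ‖f y‖ₑ) x := by
  have hc := kernelMass_pos (n := n)
  rw [diracPotential, enorm_smul, enorm_I_mul_inv_kernelMass, ENNReal.ofReal_mul (by positivity), mul_assoc,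
    ofReal_norm (cliffordMul α)]
  gcongr
  refine (enorm_integral_le_lintegral_enorm _).trans ?_
  refine (lintegral_mono fun y => enorm_diracKernel_apply_le α (x - y) (f y)).trans ?_
  rw [lintegral_const_mul' _ _ enorm_ne_top]
  rfl

/-- A weak solution is the potential of the right-hand side of its equation. -/
theorem IsWeakSolution.ae_eq_diracPotential [NeZero n] {α : Fin n → SpinorMatrix m} (hα : IsClifford α)
    (hH : ∀ j, (α j).IsHermitian) {h : Euc n → Spinor m → SpinorMatrix m} {ψ : Euc n → Spinor m}
    (hψ : IsWeakSolution α h ψ) (hloc : LocallyIntegrable ψ) {s A : ℝ} (hs : s < 1) (hA : 0 ≤ A)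
    (hw : WeakBound s A fun x => ‖ψ x‖ₑ)
    (hfin : ∀ᵐ x, rieszPotential (fun y => ‖matOp (h y (ψ y)) (ψ y)‖ₑ) x < ⊤) :
    diracPotential α (fun y => matOp (h y (ψ y)) (ψ y)) =ᵐ[volume] ψ := by
  have hc := kernelMass_pos (n := n)
  set f : Euc n → Spinor m := fun y => matOp (h y (ψ y)) (ψ y) with hf
  have hfm : AEStronglyMeasurable f := hψ.rhs_measurable
  filter_upwards [ae_tendsto_integral_massProfile hloc, hfin] with x hx1 hx2
  have hx3 := tendsto_integral_massProfile_zero hs hw hA x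
  have hint := integrable_diracKernel_apply α hfm hx2
  -- the full kernel, in the form in which it is approximated by the truncated ones
  have hker : ∀ y, y ≠ x → (‖y - x‖ ^ 2) ^ (-((n : ℝ) / 2)) • cliffordMul α (y - x) (f y) =
      -diracKernel α (x - y) (f y) := by
    intro y hy
    have hpos : 0 < ‖y - x‖ := norm_pos_iff.2 (sub_ne_zero.2 hy)
    have e : (‖y - x‖ ^ 2) ^ (-((n : ℝ) / 2)) = (‖x - y‖ ^ n)⁻¹ := by
      rw [← Real.rpow_natCast, ← Real.rpow_mul hpos.le,
        show ((2 : ℕ) : ℝ) * -((n : ℝ) / 2) = -n by push_cast; ring, Real.rpow_neg hpos.le,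
        Real.rpow_natCast, norm_sub_rev]
    rw [e, ← neg_sub x y, map_neg, neg_apply, smul_neg, diracKernel, map_smul, smul_apply]
  have hbound : ∀ k : ℕ, ∀ᵐ y, ‖truncatedProfile n ((k : ℝ) + 1)⁻¹ ((k : ℝ) + 1) (‖y - x‖ ^ 2) •
      cliffordMul α (y - x) (f y)‖ ≤ ‖diracKernel α (x - y) (f y)‖ := by
    intro k
    filter_upwards [ae_ne_point x] with y hy
    have hpos : 0 < ‖y - x‖ := norm_pos_iff.2 (sub_ne_zero.2 hy)
    rw [← norm_neg (diracKernel α (x - y) (f y)), ← hker y hy, norm_smul, norm_smul]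
    gcongr
    rw [Real.norm_eq_abs, Real.norm_of_nonneg (by positivity)]
    exact abs_truncatedProfile_le n (by positivity) (by positivity) (by positivity)
  have hmeas : ∀ k : ℕ, AEStronglyMeasurable fun y =>
      truncatedProfile n ((k : ℝ) + 1)⁻¹ ((k : ℝ) + 1) (‖y - x‖ ^ 2) • cliffordMul α (y - x) (f y) := by
    intro k
    have h1 : Continuous fun y : Euc n =>
        truncatedProfile n ((k : ℝ) + 1)⁻¹ ((k : ℝ) + 1) (‖y - x‖ ^ 2) :=
      (contDiff_truncatedProfile n _ _).continuous.comp (by fun_prop)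
    have h2 : Continuous fun y : Euc n => cliffordMul α (y - x) :=
      (cliffordMul α).continuous.comp (by fun_prop)
    exact h1.aestronglyMeasurable.smul
      ((isBoundedBilinearMap_apply (𝕜 := ℂ) (E := Spinor m) (F := Spinor m)).continuous
        |>.comp_aestronglyMeasurable (h2.aestronglyMeasurable.prodMk hfm))
  have hrhs : Tendsto (fun k : ℕ => ∫ y, truncatedProfile n ((k : ℝ) + 1)⁻¹ ((k : ℝ) + 1) (‖y - x‖ ^ 2) •
      cliffordMul α (y - x) (f y)) atTop (𝓝 (∫ y, -diracKernel α (x - y) (f y))) := by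
    refine tendsto_integral_of_dominated_convergence _ hmeas hint.norm hbound ?_
    filter_upwards [ae_ne_point x] with y hy
    have hpos : 0 < ‖y - x‖ := norm_pos_iff.2 (sub_ne_zero.2 hy)
    rw [← hker y hy]
    exact (tendsto_truncatedProfile n (by positivity)).smul_const _
  have hlhs := ((hx1.sub hx3).const_smul Complex.I)
  have heq := tendsto_nhds_unique (hlhs.congr fun k => ?_) hrhs
  · rw [sub_zero, integral_neg] at heq
    rw [diracPotential, mul_smul, smul_comm, ← neg_neg (∫ y, diracKernel α (x - y) (f y)), ← heq]
    have e : ∀ w : Spinor m, (((kernelMass n)⁻¹ : ℝ) : ℂ) • w = (kernelMass n)⁻¹ • w := fun w =>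
      Complex.coe_smul _ _
    rw [e, smul_neg, smul_smul, Complex.I_mul_I, neg_one_smul, neg_neg, smul_smul,
      inv_mul_cancel₀ hc.ne', one_smul]
  · have hk : (0 : ℝ) < (k : ℝ) + 1 := by positivity
    have hk1 : ((k : ℝ) + 1)⁻¹ ≤ (k : ℝ) + 1 := by
      have : (1 : ℝ) ≤ (k : ℝ) + 1 := by linarith [Nat.cast_nonneg (α := ℝ) k]
      exact (inv_le_one_of_one_le₀ this).trans this
    have hi1 := integrable_massProfile_smul hloc x (inv_pos.2 hk)
    have hi2 := integrable_massProfile_smul hloc x hk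
    rw [← integral_sub hi1 hi2]
    have e : ∀ y : Euc n, ((((k : ℝ) + 1)⁻¹ ^ n)⁻¹ * massProfile n (‖y - x‖ ^ 2 / ((k : ℝ) + 1)⁻¹ ^ 2)) • ψ y -
        ((((k : ℝ) + 1) ^ n)⁻¹ * massProfile n (‖y - x‖ ^ 2 / ((k : ℝ) + 1) ^ 2)) • ψ y =
        (2 * ‖y - x‖ ^ 2 * deriv (truncatedProfile n ((k : ℝ) + 1)⁻¹ ((k : ℝ) + 1)) (‖y - x‖ ^ 2) +
          n * truncatedProfile n ((k : ℝ) + 1)⁻¹ ((k : ℝ) + 1) (‖y - x‖ ^ 2)) • ψ y := fun y => by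
      rw [truncatedProfile_divergence, sub_smul]
    have hi := hi1.sub hi2
    have hi' := hi.congr (Eventually.of_forall e)
    simp only [e]
    exact hψ.integral_radialSpinor hα hH (contDiff_truncatedProfile n _ _) hk.le
      (fun s hs => truncatedProfile_of_ge n (inv_pos.2 hk) hk1 hs) x hi'
      (hint.norm.mono' (hmeas k) (hbound k))


/-- The estimate `|f(y)| ≤ D (1 + |y|) ^ (-r)`, in extended nonnegative reals. -/
def DecayBound (D r : ℝ) (f : Euc n → Spinor m) : Prop :=
  ∀ᵐ y, ‖f y‖ₑ ≤ ENNReal.ofReal D * ENNReal.ofReal ((1 + ‖y‖) ^ (-r))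

theorem DecayBound.lintegral_mul_le {D r : ℝ} {f : Euc n → Spinor m} (hf : DecayBound D r f)
    (g : Euc n → ℝ≥0∞) : ∫⁻ y, g y * ‖f y‖ₑ ≤
      ENNReal.ofReal D * ∫⁻ y, g y * ENNReal.ofReal ((1 + ‖y‖) ^ (-r)) := by
  rw [← lintegral_const_mul' _ _ ENNReal.ofReal_ne_top]
  refine lintegral_mono_ae ?_
  filter_upwards [hf] with y hy
  rw [mul_left_comm]
  gcongr

theorem DecayBound.integrable {D r : ℝ} {f : Euc n → Spinor m} (hf : DecayBound D r f)
    (hr : (n : ℝ) < r) (hfm : AEStronglyMeasurable f) : Integrable f := by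
  refine ⟨hfm, ?_⟩
  have h := hf.lintegral_mul_le (fun _ => 1)
  simp only [one_mul] at h
  refine lt_of_le_of_lt h (ENNReal.mul_lt_top ENNReal.ofReal_lt_top ?_)
  exact finite_integral_one_add_norm (μ := (volume : Measure (Euc n))) (by simpa using hr)

theorem DecayBound.exists_rieszPotential_le (hn : 2 ≤ n) {D : ℝ} (hD : 0 < D) {f : Euc n → Spinor m}
    (hf : DecayBound D (n + 1) f) :
    ∃ C : ℝ, 0 < C ∧ ∀ x, rieszPotential (fun y => ‖f y‖ₑ) x ≤ ENNReal.ofReal C ∧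
      (1 ≤ ‖x‖ → rieszPotential (fun y => ‖f y‖ₑ) x ≤ ENNReal.ofReal (C * ‖x‖ ^ (-((n : ℝ) - 1)))) := by
  have : NeZero n := ⟨by omega⟩
  have hn' : (2 : ℝ) ≤ n := by exact_mod_cast hn
  obtain ⟨C, hC, h⟩ := exists_lintegral_riesz_kernel_decay_le (n := n) (b := (n : ℝ) - 1) (r := n + 1)
    (by linarith) (by linarith) (by linarith)
  refine ⟨D * C, by positivity, fun x => ⟨?_, fun hx => ?_⟩⟩
  · refine (hf.lintegral_mul_le _).trans ?_
    rw [ENNReal.ofReal_mul hD.le]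
    gcongr
    exact (h x).1
  · refine (hf.lintegral_mul_le _).trans ?_
    rw [mul_assoc, ENNReal.ofReal_mul hD.le]
    gcongr
    exact (h x).2 hx

/-- The potential of `f` is uniformly Hölder continuous, of every exponent below one. -/
theorem DecayBound.exists_diracPotential_sub_le (hn : 2 ≤ n) (α : Fin n → SpinorMatrix m) {D : ℝ}
    (hD : 0 < D) {f : Euc n → Spinor m} (hf : DecayBound D (n + 1) f) (hfm : AEStronglyMeasurable f)
    {a : ℝ} (ha0 : 0 ≤ a) (ha1 : a < 1) :
    ∃ C : ℝ, 0 < C ∧ ∀ x x', ‖diracPotential α f x - diracPotential α f x'‖ₑ ≤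
      ENNReal.ofReal C * ‖x - x'‖ₑ ^ a := by
  have : NeZero n := ⟨by omega⟩
  have hc := kernelMass_pos (n := n)
  have hn' : (2 : ℝ) ≤ n := by exact_mod_cast hn
  obtain ⟨C₀, hC₀, hpot⟩ := hf.exists_rieszPotential_le hn hD
  obtain ⟨C₁, hC₁, h₁⟩ := exists_lintegral_riesz_kernel_decay_le (n := n) (b := (n : ℝ) - 1 + a)
    (r := n + 1) (by linarith) (by linarith) (by linarith)
  obtain ⟨C₂, hC₂, h₂⟩ := exists_enorm_diracKernel_sub_le hn α
  have hint : ∀ x, Integrable fun y => diracKernel α (x - y) (f y) := fun x =>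
    integrable_diracKernel_apply α hfm (lt_of_le_of_lt (hpot x).1 ENNReal.ofReal_lt_top)
  have hJ : ∀ x, ∫⁻ y, ‖x - y‖ₑ ^ (-((n : ℝ) - 1 + a)) * ‖f y‖ₑ ≤ ENNReal.ofReal (D * C₁) := fun x => by
    refine (hf.lintegral_mul_le _).trans ?_
    rw [ENNReal.ofReal_mul hD.le]
    gcongr
    exact (h₁ x).1
  refine ⟨(kernelMass n)⁻¹ * C₂ * (D * C₁ + D * C₁), by positivity, fun x x' => ?_⟩
  rw [diracPotential, diracPotential, ← smul_sub, ← integral_sub (hint x) (hint x'), enorm_smul,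
    enorm_I_mul_inv_kernelMass, ENNReal.ofReal_mul (by positivity), ENNReal.ofReal_mul (by positivity),
    mul_assoc, mul_assoc]
  gcongr
  calc _ ≤ ∫⁻ y, ‖diracKernel α (x - y) (f y) - diracKernel α (x' - y) (f y)‖ₑ :=
        enorm_integral_le_lintegral_enorm _
    _ ≤ ∫⁻ y, ENNReal.ofReal C₂ * ‖x - x'‖ₑ ^ a * (‖x - y‖ₑ ^ (-((n : ℝ) - 1 + a)) * ‖f y‖ₑ +
          ‖x' - y‖ₑ ^ (-((n : ℝ) - 1 + a)) * ‖f y‖ₑ) := by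
        refine lintegral_mono_ae ?_
        filter_upwards [ae_ne_point x, ae_ne_point x'] with y hy hy'
        have := h₂ a ha0 ha1.le (x - y) (x' - y) (sub_ne_zero.2 hy.symm) (sub_ne_zero.2 hy'.symm) (f y)
        rw [sub_sub_sub_cancel_right, add_mul] at this
        exact this
    _ ≤ ENNReal.ofReal C₂ * ‖x - x'‖ₑ ^ a * (ENNReal.ofReal (D * C₁) + ENNReal.ofReal (D * C₁)) := by
        rw [lintegral_const_mul' _ _ (ENNReal.mul_ne_top ENNReal.ofReal_ne_top
          (ENNReal.rpow_ne_top_of_nonneg ha0 enorm_ne_top)), lintegral_add_left']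
        · gcongr
          · exact hJ x
          · exact hJ x'
        · exact AEMeasurable.mul (by fun_prop) hfm.enorm
    _ = _ := by
        rw [← ENNReal.ofReal_add (by positivity) (by positivity)]
        ring

/-- At infinity, the potential of `f` is asymptotic to the fundamental solution applied to `∫ f`. -/
theorem DecayBound.exists_diracPotential_asymptotics (hn : 2 ≤ n) (α : Fin n → SpinorMatrix m) {D : ℝ}
    (hD : 0 < D) {f : Euc n → Spinor m} (hf : DecayBound D (n + 1) f) (hfm : AEStronglyMeasurable f)
    {a : ℝ} (ha0 : 0 ≤ a) (ha1 : a < 1) :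
    ∃ C : ℝ, 0 < C ∧ ∀ x, 1 ≤ ‖x‖ → ‖diracPotential α f x -
      (Complex.I * ((kernelMass n)⁻¹ : ℝ)) • diracKernel α x (∫ y, f y)‖ₑ ≤
      ENNReal.ofReal (C * ‖x‖ ^ (-((n : ℝ) - 1 + a))) := by
  have : NeZero n := ⟨by omega⟩
  have hc := kernelMass_pos (n := n)
  have hn' : (2 : ℝ) ≤ n := by exact_mod_cast hn
  obtain ⟨C₀, hC₀, hpot⟩ := hf.exists_rieszPotential_le hn hD
  obtain ⟨C₁, hC₁, h₁⟩ := exists_lintegral_riesz_kernel_decay_le (n := n) (b := (n : ℝ) - 1 + a)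
    (r := n + 1 - a) (by linarith) (by linarith) (by linarith)
  obtain ⟨C₂, hC₂, h₂⟩ := exists_enorm_diracKernel_sub_le hn α
  have hfi : Integrable f := hf.integrable (by linarith) hfm
  set J := ∫⁻ y : Euc n, ENNReal.ofReal ((1 + ‖y‖) ^ (-(n + 1 - a : ℝ))) with hJdef
  have hJ : J < ⊤ := finite_integral_one_add_norm (μ := (volume : Measure (Euc n))) (by
    simp only [finrank_euclideanSpace_fin]; linarith)
  -- the weight `|y| ^ a` costs `a` powers of the decay of `f`
  have hweight : ∀ᵐ y, ‖y‖ₑ ^ a * ‖f y‖ₑ ≤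
      ENNReal.ofReal D * ENNReal.ofReal ((1 + ‖y‖) ^ (-(n + 1 - a : ℝ))) := by
    filter_upwards [hf] with y hy
    have hy0 : 0 < 1 + ‖y‖ := by linarith [norm_nonneg y]
    calc ‖y‖ₑ ^ a * ‖f y‖ₑ ≤ ENNReal.ofReal ((1 + ‖y‖) ^ a) *
          (ENNReal.ofReal D * ENNReal.ofReal ((1 + ‖y‖) ^ (-(n + 1 : ℝ)))) := by
          gcongr
          rw [← ofReal_norm, ENNReal.ofReal_rpow_of_nonneg (norm_nonneg y) ha0]
          refine ENNReal.ofReal_le_ofReal ?_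
          gcongr
          linarith
      _ = _ := by
          rw [mul_left_comm, ← ENNReal.ofReal_mul (by positivity), ← Real.rpow_add hy0]
          congr 3
          ring
  refine ⟨(kernelMass n)⁻¹ * C₂ * D * (C₁ + J.toReal), by positivity, fun x hx => ?_⟩
  have hx0 : 0 < ‖x‖ := by linarith
  have hxne : x ≠ 0 := norm_pos_iff.1 hx0
  have hint : Integrable fun y => diracKernel α (x - y) (f y) :=
    integrable_diracKernel_apply α hfm (lt_of_le_of_lt (hpot x).1 ENNReal.ofReal_lt_top)
  rw [diracPotential, ← ContinuousLinearMap.integral_comp_comm _ hfi, ← smul_sub,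
    ← integral_sub hint ((diracKernel α x).integrable_comp hfi), enorm_smul, enorm_I_mul_inv_kernelMass]
  calc _ ≤ ENNReal.ofReal (kernelMass n)⁻¹ * ∫⁻ y, ‖diracKernel α (x - y) (f y) - diracKernel α x (f y)‖ₑ := by
        gcongr
        exact enorm_integral_le_lintegral_enorm _
    _ ≤ ENNReal.ofReal (kernelMass n)⁻¹ * ∫⁻ y, ENNReal.ofReal C₂ * (ENNReal.ofReal D *
          (‖x - y‖ₑ ^ (-((n : ℝ) - 1 + a)) * ENNReal.ofReal ((1 + ‖y‖) ^ (-(n + 1 - a : ℝ))) +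
          ‖x‖ₑ ^ (-((n : ℝ) - 1 + a)) * ENNReal.ofReal ((1 + ‖y‖) ^ (-(n + 1 - a : ℝ))))) := by
        gcongr ENNReal.ofReal (kernelMass n)⁻¹ * ?_
        refine lintegral_mono_ae ?_
        filter_upwards [ae_ne_point x, hweight] with y hy hw
        have h3 := h₂ a ha0 ha1.le (x - y) x (sub_ne_zero.2 hy.symm) hxne (f y)
        rw [sub_sub_cancel_left, enorm_neg, mul_assoc] at h3
        refine h3.trans (mul_le_mul_right ?_ _)
        calc _ = (‖x - y‖ₑ ^ (-((n : ℝ) - 1 + a)) + ‖x‖ₑ ^ (-((n : ℝ) - 1 + a))) *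
              (‖y‖ₑ ^ a * ‖f y‖ₑ) := by ring
          _ ≤ _ := mul_le_mul_right hw _
          _ = _ := by ring
    _ ≤ ENNReal.ofReal (kernelMass n)⁻¹ * (ENNReal.ofReal C₂ * (ENNReal.ofReal D *
          (ENNReal.ofReal (C₁ * ‖x‖ ^ (-((n : ℝ) - 1 + a))) +
            ENNReal.ofReal (J.toReal * ‖x‖ ^ (-((n : ℝ) - 1 + a)))))) := by
        rw [lintegral_const_mul' _ _ ENNReal.ofReal_ne_top, lintegral_const_mul' _ _ ENNReal.ofReal_ne_top,
          lintegral_add_left (by fun_prop)]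
        gcongr
        · exact (h₁ x).2 hx
        · rw [lintegral_const_mul _ (by fun_prop), ← hJdef, mul_comm J.toReal,
            ENNReal.ofReal_mul (by positivity), ENNReal.ofReal_toReal hJ.ne, ← ofReal_norm,
            ENNReal.ofReal_rpow_of_pos hx0]
    _ = _ := by
        rw [← ENNReal.ofReal_add (by positivity) (by positivity), ← ENNReal.ofReal_mul hD.le,
          ← ENNReal.ofReal_mul hC₂.le, ← ENNReal.ofReal_mul (by positivity)]
        congr 1
        ring

end DiracPotential

/-! ### Decay of the nonlinearity, and the matrix of the Kelvin transform -/

section Main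
variable {n m : ℕ}

/-- For `u ∈ L^{2♯}` the potential of `u ^ q` is finite almost everywhere. -/
theorem ae_rieszPotential_lt_top_of_critical (hn : 2 ≤ n) {u : Euc n → ℝ≥0∞} (hu : Measurable u)
    (hp : ∫⁻ x, u x ^ (2 * (n : ℝ) / (n - 1)) ≠ ⊤) :
    ∀ᵐ x, rieszPotential (fun y => u y ^ (((n : ℝ) + 1) / (n - 1))) x < ⊤ := by
  have hn' : (2 : ℝ) ≤ n := by exact_mod_cast hn
  have h1 : (0 : ℝ) < n - 1 := by linarith
  set J := ∫⁻ x, u x ^ (2 * (n : ℝ) / (n - 1)) with hJ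
  set r := 2 * (n : ℝ) / (n + 1) with hr
  have hr1 : 1 < r := by rw [hr, lt_div_iff₀ (by linarith)]; linarith
  have hum : Measurable fun y => u y ^ (((n : ℝ) + 1) / (n - 1)) := hu.pow_const _
  have hw : WeakBound (1 - 1 / r) (J.toReal ^ (1 / r) + 1) fun y => u y ^ (((n : ℝ) + 1) / (n - 1)) := by
    refine weakBound_of_lintegral_rpow_le hr1 (by positivity) hum ?_
    have e : ∀ x, (u x ^ (((n : ℝ) + 1) / (n - 1))) ^ r = u x ^ (2 * (n : ℝ) / (n - 1)) := fun x => by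
      rw [← ENNReal.rpow_mul, hr]
      congr 1
      field_simp
    simp only [e]
    exact le_ofReal_rpow_toReal_add_one hp (by positivity)
  have e : 1 - 1 / r = ((n : ℝ) - 1) / (2 * n) := by rw [hr]; field_simp; ring
  obtain ⟨C, hC, h⟩ := exists_weakBound_rieszPotential hn (s := 1 - 1 / r)
    (by rw [e]; positivity) (by
      rw [e, show 1 - 1 / (n : ℝ) = (n - 1) / n by field_simp]
      gcongr
      linarith)
  exact (h _ _ (by positivity) hum hw).ae_lt_top (measurable_rieszPotential hum)

/-- The critical power of a function bounded by `min (1, |x| ^ (-(n - 1)))`. -/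
theorem rpow_critical_le (hn : 2 ≤ n) {M t : ℝ} (hM : 0 < M) (ht : 0 < t) {U : ℝ≥0∞}
    (h₁ : U ≤ ENNReal.ofReal M) (h₂ : U ≤ ENNReal.ofReal (M * t ^ (-((n : ℝ) - 1)))) :
    U ^ (((n : ℝ) + 1) / (n - 1)) ≤
      ENNReal.ofReal (M ^ (((n : ℝ) + 1) / (n - 1)) * 2 ^ ((n : ℝ) + 1) * (1 + t) ^ (-((n : ℝ) + 1))) := by
  have hn' : (2 : ℝ) ≤ n := by exact_mod_cast hn
  have h1 : (0 : ℝ) < n - 1 := by linarith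
  set q := ((n : ℝ) + 1) / (n - 1) with hq
  have hq0 : 0 < q := by positivity
  have e2 : (2 : ℝ) ^ ((n : ℝ) + 1) * (1 + t) ^ (-((n : ℝ) + 1)) = ((1 + t) / 2) ^ (-((n : ℝ) + 1)) := by
    rw [Real.div_rpow (by positivity) (by norm_num), Real.rpow_neg (by norm_num : (0 : ℝ) ≤ 2),
      div_inv_eq_mul, mul_comm]
  rw [mul_assoc, e2]
  rcases le_total t 1 with h | h
  · refine (ENNReal.rpow_le_rpow h₁ hq0.le).trans ?_
    rw [ENNReal.ofReal_rpow_of_pos hM]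
    refine ENNReal.ofReal_le_ofReal (le_mul_of_one_le_right (by positivity) ?_)
    exact Real.one_le_rpow_of_pos_of_le_one_of_nonpos (by positivity) (by linarith) (by linarith)
  · refine (ENNReal.rpow_le_rpow h₂ hq0.le).trans ?_
    rw [ENNReal.ofReal_rpow_of_pos (by positivity), Real.mul_rpow hM.le (by positivity),
      ← Real.rpow_mul ht.le, hq, neg_mul, mul_div_cancel₀ _ h1.ne']
    refine ENNReal.ofReal_le_ofReal (mul_le_mul_of_nonneg_left ?_ (by positivity))
    exact Real.rpow_le_rpow_of_nonpos (by positivity) (by linarith) (by linarith)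

/-- Boundedness and decay of a weak solution, in terms of the right-hand side of its equation. The
solution is also recovered as the potential of this right-hand side. -/
theorem IsWeakSolution.exists_decayBound (hn : 2 ≤ n) {α : Fin n → SpinorMatrix m} (hα : IsClifford α)
    (hH : ∀ j, (α j).IsHermitian) {h : Euc n → Spinor m → SpinorMatrix m}
    (hh : ∃ C : ℝ, ∀ x z, ‖matOp (h x z)‖ ≤ C * ‖z‖ ^ (critExp n - 2)) {ψ : Euc n → Spinor m}
    (hψ : IsWeakSolution α h ψ) :
    (diracPotential α (fun y => matOp (h y (ψ y)) (ψ y)) =ᵐ[volume] ψ) ∧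
      ∃ D : ℝ, 0 < D ∧ DecayBound D (n + 1) fun y => matOp (h y (ψ y)) (ψ y) := by
  have : NeZero n := ⟨by omega⟩
  have hn' : (2 : ℝ) ≤ n := by exact_mod_cast hn
  have h1 : (0 : ℝ) < n - 1 := by linarith
  obtain ⟨C₀, hC₀⟩ := hh
  set C := max C₀ 1 with hC
  have hC0 : 0 < C := by positivity
  set q := ((n : ℝ) + 1) / (n - 1) with hq
  have hq0 : 0 < q := by positivity
  set p := 2 * (n : ℝ) / (n - 1) with hp
  have hp1 : 1 < p := by rw [hp, lt_div_iff₀ h1]; linarith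
  have hcrit : critExp n = p := rfl
  -- the modulus of the solution, as a measurable function
  have hψm : AEStronglyMeasurable ψ := hψ.memLp.1
  set u : Euc n → ℝ≥0∞ := fun x => ‖hψm.mk ψ x‖ₑ with hu
  have hum : Measurable u := hψm.stronglyMeasurable_mk.enorm
  have huψ : ∀ᵐ x, ‖ψ x‖ₑ = u x := by
    filter_upwards [hψm.ae_eq_mk] with x hx
    rw [hu, hx]
  have hup : ∫⁻ x, u x ^ p ≠ ⊤ := by
    have h2 := lintegral_rpow_enorm_lt_top_of_eLpNorm_lt_top (by simp [hcrit]; linarith)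
      ENNReal.ofReal_ne_top hψ.memLp.2
    rw [hcrit, ENNReal.toReal_ofReal (by linarith)] at h2
    refine ne_of_lt (lt_of_le_of_lt (le_of_eq (lintegral_congr_ae ?_)) h2)
    filter_upwards [huψ] with x hx
    rw [hx]
  set f : Euc n → Spinor m := fun y => matOp (h y (ψ y)) (ψ y) with hf
  have hfu : ∀ᵐ y, ‖f y‖ₑ ≤ ENNReal.ofReal C * u y ^ q := by
    filter_upwards [huψ] with y hy
    rw [← hy, ← ofReal_norm, ← ofReal_norm (ψ y), ENNReal.ofReal_rpow_of_nonneg (norm_nonneg _) hq0.le,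
      ← ENNReal.ofReal_mul hC0.le]
    refine ENNReal.ofReal_le_ofReal ?_
    calc ‖f y‖ ≤ ‖matOp (h y (ψ y))‖ * ‖ψ y‖ := ContinuousLinearMap.le_opNorm _ _
      _ ≤ (C * ‖ψ y‖ ^ (critExp n - 2)) * ‖ψ y‖ := by
          gcongr
          refine (hC₀ y (ψ y)).trans ?_
          gcongr
          exact le_max_left _ _
      _ = C * ‖ψ y‖ ^ q := by
          have e : q = critExp n - 2 + 1 := by rw [hcrit, hq, hp]; field_simp; ring
          have e' : critExp n - 2 = 2 / (n - 1) := by rw [hcrit, hp]; field_simp; ring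
          rw [e, e', Real.rpow_add_one' (norm_nonneg _) (by positivity), mul_assoc]
  have hpot : ∀ x, rieszPotential (fun y => ‖f y‖ₑ) x ≤
      ENNReal.ofReal C * rieszPotential (fun y => u y ^ q) x := fun x => by
    rw [← rieszPotential_const_mul ENNReal.ofReal_ne_top]
    exact rieszPotential_mono hfu x
  have hfin : ∀ᵐ x, rieszPotential (fun y => ‖f y‖ₑ) x < ⊤ := by
    filter_upwards [ae_rieszPotential_lt_top_of_critical hn hum hup] with x hx
    exact lt_of_le_of_lt (hpot x) (ENNReal.mul_lt_top ENNReal.ofReal_lt_top hx)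
  have hloc : LocallyIntegrable ψ := hψ.memLp.locallyIntegrable (by
    rw [hcrit]; exact ENNReal.one_le_ofReal.2 hp1.le)
  have hweak : WeakBound (1 - 1 / p) ((∫⁻ x, u x ^ p).toReal ^ (1 / p) + 1) fun x => ‖ψ x‖ₑ := by
    refine WeakBound.mono (g := u) ?_ (huψ.mono fun x hx => hx.le)
    exact weakBound_of_lintegral_rpow_le hp1 (by positivity) hum
      (le_ofReal_rpow_toReal_add_one hup (by positivity))
  have hrep := hψ.ae_eq_diracPotential hα hH hloc (s := 1 - 1 / p) (by
    have : 0 < 1 / p := by positivity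
    linarith) (by positivity) hweak hfin
  refine ⟨hrep, ?_⟩
  have hc := kernelMass_pos (n := n)
  obtain ⟨M, hM, hdecay⟩ := exists_ae_le_rpow_of_critical hn hum hup
    (C := (kernelMass n)⁻¹ * ‖cliffordMul α‖ * C + 1) (by positivity) (by
      filter_upwards [hrep, huψ] with x hx hx'
      rw [← hx', ← hx]
      refine (enorm_diracPotential_le α f x).trans ?_
      refine (mul_le_mul_right (hpot x) _).trans ?_
      rw [← mul_assoc, ← ENNReal.ofReal_mul (by positivity)]
      gcongr
      linarith)
  refine ⟨C * (M ^ q * 2 ^ ((n : ℝ) + 1)), by positivity, ?_⟩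
  filter_upwards [hfu, hdecay, ae_ne_point (0 : Euc n)] with y hy hy' hy0
  refine hy.trans ?_
  rw [ENNReal.ofReal_mul hC0.le, mul_assoc, ← ENNReal.ofReal_mul (by positivity)]
  gcongr
  exact rpow_critical_le hn hM (norm_pos_iff.2 hy0) hy'.1 hy'.2

/-- The grading `diag (1, -1)` of the spinor space. -/
def gradingMatrix (m : ℕ) : SpinorMatrix m := Matrix.fromBlocks 1 0 0 (-1)

theorem kelvinMatrix_mul_gradingMatrix (σ : Fin n → Matrix (Fin m) (Fin m) ℂ) (x : Euc n) :
    kelvinMatrix σ x * gradingMatrix m =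
      Complex.I • ∑ j, ((x j / ‖x‖ : ℝ) : ℂ) • diracMatrix σ j := by
  unfold kelvinMatrix gradingMatrix diracMatrix
  rw [Matrix.fromBlocks_multiply]
  ext (i | i) (j | j)
  · simp [Matrix.sum_apply]
  · simp [Matrix.sum_apply, Matrix.conjTranspose_sum]
  · simp [Matrix.sum_apply]
  · simp [Matrix.sum_apply]

/-- The fundamental solution in terms of `𝒰(x)`, which is `i |x|⁻¹ ∑ⱼ xⱼ αⱼ` up to the grading. -/
theorem I_smul_diracKernel_eq [NeZero n] (σ : Fin n → Matrix (Fin m) (Fin m) ℂ) {x : Euc n} (hx : x ≠ 0)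
    (c : ℝ) (w : Spinor m) : (Complex.I * (c : ℂ)) • diracKernel (diracMatrix σ) x w =
      ‖x‖ ^ (-(n : ℝ) + 1) • matOp (kelvinMatrix σ x) (c • matOp (gradingMatrix m) w) := by
  have hx0 : 0 < ‖x‖ := norm_pos_iff.2 hx
  have h1 : matOp (kelvinMatrix σ x) (matOp (gradingMatrix m) w) =
      Complex.I • (‖x‖⁻¹ • cliffordMul (diracMatrix σ) x w) := by
    rw [← matOp_mul, kelvinMatrix_mul_gradingMatrix, cliffordMul_apply_apply]
    simp only [matOp, map_smul, map_sum, smul_apply, sum_apply, Finset.smul_sum, smul_smul]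
    refine Finset.sum_congr rfl fun j _ => ?_
    rw [mul_smul, Complex.coe_smul, div_eq_inv_mul]
  rw [ContinuousLinearMap.map_smul_of_tower, h1, diracKernel, map_smul, smul_apply, mul_smul,
    Real.rpow_add hx0, Real.rpow_one, Real.rpow_neg hx0.le,
    Real.rpow_natCast, Complex.coe_smul]
  rw [smul_comm c Complex.I, smul_comm ((‖x‖ ^ n)⁻¹ * ‖x‖) Complex.I]
  simp only [smul_smul]
  congr 2
  field_simp

end Main

/-- `ψ₀` is the continuous representative of the almost-everywhere class of `ψ`. -/
theorem theorem1p1 (n m : ℕ) (hn : 2 ≤ n)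
    (σ : Fin n → Matrix (Fin m) (Fin m) ℂ) (hσ : IsClifford (diracMatrix σ))
    (h : EuclideanSpace ℝ (Fin n) → Spinor m → SpinorMatrix m)
    (hh : ∃ C : ℝ, ∀ x z, ‖matOp (h x z)‖ ≤ C * ‖z‖ ^ (critExp n - 2))
    (ψ : EuclideanSpace ℝ (Fin n) → Spinor m)
    (hψ : IsWeakSolution (diracMatrix σ) h ψ) :
    ∃ ψ₀ : EuclideanSpace ℝ (Fin n) → Spinor m, ψ₀ =ᵐ[MeasureTheory.volume] ψ ∧
      (∀ a : ℝ≥0, 0 < a → a < 1 → IsHolderClass a ψ₀) ∧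
      (∃ Ψ : Spinor m, ∀ a : ℝ, a < 1 → ∃ C : ℝ, ∀ x : EuclideanSpace ℝ (Fin n), 1 ≤ ‖x‖ →
        ‖ψ₀ x - ‖x‖ ^ (-(n : ℝ) + 1) • matOp (kelvinMatrix σ x) Ψ‖
          ≤ C * ‖x‖ ^ (-(n : ℝ) + 1 - a)) ∧
      (∃ C : ℝ, ∀ x : EuclideanSpace ℝ (Fin n), ‖ψ₀ x‖ ≤ C / (1 + ‖x‖ ^ (n - 1))) := by
  have : NeZero n := ⟨by omega⟩
  have hc := kernelMass_pos (n := n)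
  obtain ⟨hrep, D, hD, hf⟩ := hψ.exists_decayBound hn hσ (isHermitian_diracMatrix σ) hh
  have hfm := hψ.rhs_measurable
  set f : Euc n → Spinor m := fun y => matOp (h y (ψ y)) (ψ y) with hfdef
  set α := diracMatrix σ with hα
  obtain ⟨C₀, hC₀, hpot⟩ := hf.exists_rieszPotential_le hn hD
  set L := (kernelMass n)⁻¹ * ‖cliffordMul α‖ with hL
  have hL0 : 0 ≤ L := by positivity
  have hbdd : ∀ x, ‖diracPotential α f x‖ ≤ L * C₀ := by
    intro x
    have h1 := (enorm_diracPotential_le α f x).trans (mul_le_mul_right (hpot x).1 _)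
    rwa [← ENNReal.ofReal_mul hL0, ← ofReal_norm, ENNReal.ofReal_le_ofReal_iff (by positivity)] at h1
  refine ⟨diracPotential α f, hrep, fun a _ ha1 => ⟨⟨_, hbdd⟩, ?_⟩, ?_, ?_⟩
  · obtain ⟨C, hC, hCle⟩ := hf.exists_diracPotential_sub_le hn α hD hfm a.coe_nonneg (by exact_mod_cast ha1)
    refine ⟨C.toNNReal, fun x y => ?_⟩
    rw [edist_eq_enorm_sub, edist_eq_enorm_sub]
    exact hCle x y
  · refine ⟨(kernelMass n)⁻¹ • matOp (gradingMatrix m) (∫ y, f y), fun a ha => ?_⟩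
    obtain ⟨C, hC, hCle⟩ := hf.exists_diracPotential_asymptotics hn α hD hfm (le_max_right a 0)
      (max_lt ha one_pos)
    refine ⟨C, fun x hx => ?_⟩
    have hx0 : 0 < ‖x‖ := by linarith
    have h1 := hCle x hx
    rw [I_smul_diracKernel_eq σ (norm_pos_iff.1 hx0), ← ofReal_norm,
      ENNReal.ofReal_le_ofReal_iff (by positivity)] at h1
    refine h1.trans ?_
    gcongr
    linarith [le_max_left a 0]
  · refine ⟨2 * (L * C₀), fun x => ?_⟩
    rw [le_div_iff₀ (by positivity), mul_add, mul_one, two_mul]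
    refine add_le_add (hbdd x) ?_
    rcases le_total ‖x‖ 1 with hx | hx
    · exact (mul_le_of_le_one_right (norm_nonneg _) (pow_le_one₀ (norm_nonneg _) hx)).trans (hbdd x)
    · have hx0 : 0 < ‖x‖ := by linarith
      have h1 := (enorm_diracPotential_le α f x).trans (mul_le_mul_right ((hpot x).2 hx) _)
      rw [← ENNReal.ofReal_mul hL0, ← ofReal_norm, ENNReal.ofReal_le_ofReal_iff (by positivity)] at h1
      refine (mul_le_mul_of_nonneg_right h1 (by positivity)).trans (le_of_eq ?_)
      rw [← Real.rpow_natCast, Nat.cast_sub (by omega), Nat.cast_one, mul_assoc L, mul_assoc C₀,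
        ← Real.rpow_add hx0, neg_add_cancel, Real.rpow_zero, mul_one]
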